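/- **Setting.** Let $G=(V,E)$, $V=\{1,\dots,m\}$, be an undirected graph without self-loops, let $\mathcal N(i)$ be the set of neighbors of $i$, and let $f_i:\mathbb R^d\to\mathbb R$ ($i\in V$) be functions. For each $i$ let $\{\mathcal X_i^j\}_{j\in I_i}$ be a (possibly infinite) family of subsets of $\mathbb R^d$. Put $\mathcal X_i=\bigcap_{j\in I_i}\mathcal X_i^j$, $\mathcal X=\bigcap_{i\in V}\mathcal X_i$, $f=\sum_{i\in V} f_i$, and let $\mathcal X^*=\{x\in\mathcal X: f(x)=\min_{\mathcal X} f\}$. $\|\cdot\|$ is the Euclidean norm, $\mathrm{dist}(x,\mathcal Y)$ the Euclidean distance to $\mathcal Y$ and $\mathsf\Pi_{\mathcal Y}$ the Euclidean projection onto $\mathcal Y$. The index sets $I_i$ are measurable spaces, and $j\mapsto\mathrm{dist}(x,\mathcal X_i^j)$ is measurable for every $x$ and $i$. **Algorithm.** At each time $k\ge1$ a random agent $I_k$ wakes up and contacts a random agent $J_k$, and each agent $i$ has a random index $\Omega_i(k)\in I_i$. The initial points $x_i(0)\in\mathbb R^d$ may be random. With $W(k)=I-\frac12(e_{I_k}-e_{J_k})(e_{I_k}-e_{J_k})'$,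 for $k\ge 1$ and $i\in V$, $$v_i(k)=\sum_{j=1}^m[W(k)]_{ij}\,x_j(k-1),\qquad p_i(k)=\mathsf\Pi_{\mathcal X_i^{\Omega_i(k)}}\big[v_i(k)-\alpha_i(k)\nabla f_i(v_i(k))\big]-v_i(k),$$ $$x_i(k)=v_i(k)+p_i(k)\,\chi_{\{i\in\{I_k,J_k\}\}},\qquad \alpha_i(k)=\frac1{\Gamma_i(k)},$$ where $\Gamma_i(k)$ is the number of times $t\in\{1,\dots,k\}$ with $i\in\{I_t,J_t\}$ (the step size matters only when $i\in\{I_k,J_k\}$, and then $\Gamma_i(k)\ge1$). The three families $(x_i(0))_{i}$, $(I_k,J_k)_{k}$ and $(\Omega_i(k))_{i,k}$ are mutually independent. **Assumptions.** 1. $G$ is connected. The pairs $(I_k,J_k)$, $k\ge1$, are iid with $\mathsf P(I_k=i,J_k=j)=\frac1m\pi_{ij}$, where $\pi$ is a nonnegative matrix with row sums $1$, $\pi_{ij}>0$ if $j\in\mathcal N(i)$ and $\pi_{ij}=0$ otherwise. 2. All sets $\mathcal X_i^j$ are closed and convex. Each $f_i$ is convex and differentiable on $\mathbb R^d$ and satisfies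 $\|\nabla f_i(x)-\nabla f_i(y)\|\le L_i\|x-y\|$ for all $x,y\in\mathbb R^d$. There is a constant $G_f$ with $\|\nabla f_i(x)\|\le G_f$ for all $x\in\mathcal X$ and $i\in V$. 3. There is a constant $c>0$ such that for all $i\in V$, $x\in\mathbb R^d$ and $k\ge1$, almost surely, $$\mathrm{dist}^2(x,\mathcal X)\le c\,\mathsf E\big[\mathrm{dist}^2(x,\mathcal X_i^{\Omega_i(k)})\,\big|\,\Omega_\ell(t),\ 1\le t<k,\ \ell\in V\big].$$ **Proposition 1 (Convergence w.p. 1).** Suppose that Assumptions 1–3 hold and that $\mathcal X^*\neq\emptyset$. Then there is a random vector $x^\star$ such that, with probability $1$, $x^\star\in\mathcal X^*$ and $\lim_{k\to\infty}x_i(k)=x^\star$ for all $i\in V$. -/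

import Mathlib

open MeasureTheory ProbabilityTheory Filter Topology

namespace GRP

noncomputable section

/-- The global constraint set: the intersection of all component sets `C i j` of all agents `i`. -/
def feasibleSet {m d : ℕ} {ι : Fin m → Type*}
    (C : ∀ i, ι i → Set (EuclideanSpace ℝ (Fin d))) : Set (EuclideanSpace ℝ (Fin d)) :=
  ⋂ i, ⋂ j, C i j

/-- The global objective `∑ i, f i`. -/
def objective {m d : ℕ} (f : Fin m → EuclideanSpace ℝ (Fin d) → ℝ)
    (x : EuclideanSpace ℝ (Fin d)) : ℝ :=
  ∑ i, f i x

/-- The set of minimizers of the global objective over the global constraint set. -/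
def optimalSet {m d : ℕ} {ι : Fin m → Type*}
    (f : Fin m → EuclideanSpace ℝ (Fin d) → ℝ)
    (C : ∀ i, ι i → Set (EuclideanSpace ℝ (Fin d))) : Set (EuclideanSpace ℝ (Fin d)) :=
  {x | x ∈ feasibleSet C ∧ ∀ y ∈ feasibleSet C, objective f x ≤ objective f y}

/-- The Euclidean projection of `x` on `S`: the point of `S` closest to `x`
(it exists and is unique when `S` is nonempty, closed and convex). -/
def proj {d : ℕ} (S : Set (EuclideanSpace ℝ (Fin d))) (x : EuclideanSpace ℝ (Fin d)) :
    EuclideanSpace ℝ (Fin d) :=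
  Classical.epsilon fun y => y ∈ S ∧ ∀ z ∈ S, ‖y - x‖ ≤ ‖z - x‖

/-- The gossip matrix `I - (1/2) (e_a - e_b) (e_a - e_b)'`. -/
def gossipMatrix {m : ℕ} (a b : Fin m) : Matrix (Fin m) (Fin m) ℝ :=
  1 - (1 / 2 : ℝ) • Matrix.vecMulVec (Pi.single a (1 : ℝ) - Pi.single b 1)
    (Pi.single a (1 : ℝ) - Pi.single b 1)

/-- Time is counted from zero: the entry `g k` of a gossip path is the pair (waking agent,
contacted neighbor) at the `(k+1)`-st tick of the clock.  `numUpdates g i k` is the number of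
updates that agent `i` has performed up to and including that tick. -/
def numUpdates {m : ℕ} (g : ℕ → Fin m × Fin m) (i : Fin m) (k : ℕ) : ℕ :=
  ((Finset.range (k + 1)).filter fun t => i = (g t).1 ∨ i = (g t).2).card

/-- The averaged estimates `v_i = ∑ j, W_ij x_j`. -/
def mix {m d : ℕ} (W : Matrix (Fin m) (Fin m) ℝ) (x : Fin m → EuclideanSpace ℝ (Fin d))
    (i : Fin m) : EuclideanSpace ℝ (Fin d) :=
  ∑ j, W i j • x j

/-- The iterates of the gossip-based random projection algorithm with stepsizes
`1 / numUpdates`, started at `x₀`, along the gossip path `g` and the constraint samples `w`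
(`w k i` is the index of the component set of agent `i` that is used at the `(k+1)`-st tick).
`iterate f C x₀ g w k i` is the estimate of agent `i` after `k` ticks. -/
def iterate {m d : ℕ} {ι : Fin m → Type*}
    (f : Fin m → EuclideanSpace ℝ (Fin d) → ℝ)
    (C : ∀ i, ι i → Set (EuclideanSpace ℝ (Fin d)))
    (x₀ : Fin m → EuclideanSpace ℝ (Fin d))
    (g : ℕ → Fin m × Fin m) (w : ℕ → ∀ i, ι i) :
    ℕ → Fin m → EuclideanSpace ℝ (Fin d)
  | 0 => x₀
  | k + 1 => fun i =>
      let v := mix (gossipMatrix (g k).1 (g k).2) (iterate f C x₀ g w k) i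
      let α : ℝ := 1 / (numUpdates g i k : ℝ)
      let p := proj (C i (w k i)) (v - α • gradient (f i) v) - v
      v + if i = (g k).1 ∨ i = (g k).2 then p else 0

/-- The σ-algebra generated by the constraint samples of all agents at the ticks before
the one with number `k`. -/
abbrev samplePast {m : ℕ} {ι : Fin m → Type*} [∀ i, MeasurableSpace (ι i)] {S : Type*}
    (Ω : ℕ → ∀ i, S → ι i) (k : ℕ) : MeasurableSpace S :=
  ⨆ (t : ℕ) (_ : t < k) (l : Fin m), MeasurableSpace.comap (Ω t l) inferInstance

end

end GRP

/-! Fix a minimizer `y` and follow `V = 1 + ∑ l, ‖x l - y‖ ^ 2`. Averaging across an edge `(i, j)`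
lowers `V` by `‖x i - x j‖ ^ 2 / 2`. Each projected gradient step with stepsize `a l` lowers it by a
multiple of the squared distance to the sampled set and adds `-2 * a l * (f l z - f l y)`, up to
errors of order `a l ^ 2 * V`. Here `z` is the same feasible point for all agents, the projection of
the estimate of a fixed agent `r`; moving the objective gap to `z` costs a little distance to the
feasible set and a little disagreement (`norm_proj_gradient_step_sq_le`).

Averaging over the randomness makes these terms useful. Regularity turns the expected distance to
the sampled set into the distance to the feasible set. Connectivity bounds the disagreement with `r`
by the mean disagreement across a random edge (`exists_sum_norm_sub_sq_le`). Averaging over the edge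
multiplies `a l` by the probability `γ l` that agent `l` is active. As `a l` is an inverse update
count, `γ l * a l` is close to `1 / (k + 1)` for every agent, so the local gaps add up to a multiple
of the gap of the global objective; a variance bound makes the deviations summable almost surely
(`ae_summable_inv_count`).

The outcome is a drift inequality `E[V' | past] ≤ (1 + growth) * V - decrease`
(`setIntegral_edgeStep_le`) with almost surely summable growth. By `robbins_siegmund`, `V` converges
and the decrease is summable. Hence disagreement and infeasibility vanish, and since the harmonic
series diverges, the objective at `z` approaches its minimum along a subsequence. A limit point is a
minimizer. Since the distances to a countable dense set of minimizers all converge, the whole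
sequence has this limit (`exists_tendsto_of_summable_decrease`).

Two probabilistic gaps remain. Regularity is assumed at fixed points and given past samples only;
independence extends it to the full history (`condExp_samplePast_eq_condExp_history`) and simple
functions to random points (`setIntegral_comp_le_of_le_condExp`). Integrability needs bounded
initial points, which truncation provides. -/

namespace GRP

/-! ### Metric projection onto closed convex sets and its measurability -/

section Projection

variable {d : ℕ} {S : Set (EuclideanSpace ℝ (Fin d))}

theorem proj_spec (hS : IsClosed S) (hne : S.Nonempty) (x : EuclideanSpace ℝ (Fin d)) :
    proj S x ∈ S ∧ ∀ z ∈ S, ‖proj S x - x‖ ≤ ‖z - x‖ := by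
  obtain ⟨y, hy, hxy⟩ := hS.exists_infDist_eq_dist hne x
  refine Classical.epsilon_spec
    (p := fun y => y ∈ S ∧ ∀ z ∈ S, ‖y - x‖ ≤ ‖z - x‖) ⟨y, hy, fun z hz => ?_⟩
  rw [← dist_eq_norm, ← dist_eq_norm, dist_comm, dist_comm z, ← hxy]
  exact Metric.infDist_le_dist_of_mem hz

theorem proj_mem (hS : IsClosed S) (hne : S.Nonempty) (x : EuclideanSpace ℝ (Fin d)) :
    proj S x ∈ S :=
  (proj_spec hS hne x).1

theorem infDist_eq_norm_sub_proj (hS : IsClosed S) (hne : S.Nonempty)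
    (x : EuclideanSpace ℝ (Fin d)) : Metric.infDist x S = ‖x - proj S x‖ := by
  obtain ⟨h1, h2⟩ := proj_spec hS hne x
  refine le_antisymm ?_ ?_
  · rw [← dist_eq_norm]
    exact Metric.infDist_le_dist_of_mem h1
  · refine (Metric.le_infDist hne).2 fun y hy => ?_
    rw [dist_eq_norm, norm_sub_rev, norm_sub_rev x]
    exact h2 y hy

theorem inner_sub_proj_nonpos (hS : IsClosed S) (hc : Convex ℝ S) (hne : S.Nonempty)
    (x : EuclideanSpace ℝ (Fin d)) {z : EuclideanSpace ℝ (Fin d)} (hz : z ∈ S) :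
    inner ℝ (x - proj S x) (z - proj S x) ≤ 0 := by
  obtain ⟨h1, h2⟩ := proj_spec hS hne x
  refine (norm_eq_iInf_iff_real_inner_le_zero hc h1).1 ?_ z hz
  have : Nonempty S := hne.to_subtype
  refine le_antisymm (le_ciInf fun w => ?_) (ciInf_le ⟨0, ?_⟩ (⟨_, h1⟩ : S))
  · rw [norm_sub_rev, norm_sub_rev x]
    exact h2 w w.2
  · rintro _ ⟨w, rfl⟩
    positivity

/-- The angle at the projection is obtuse, so the law of cosines leaves a gain of `‖proj S x - x‖ ^
2`. This gain pays for the gradient errors and produces feasibility. -/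
theorem norm_proj_sub_sq_le (hS : IsClosed S) (hc : Convex ℝ S)
    (x : EuclideanSpace ℝ (Fin d)) {z : EuclideanSpace ℝ (Fin d)} (hz : z ∈ S) :
    ‖proj S x - z‖ ^ 2 ≤ ‖x - z‖ ^ 2 - ‖proj S x - x‖ ^ 2 := by
  have h := inner_sub_proj_nonpos hS hc ⟨z, hz⟩ x hz
  have e : ‖x - z‖ ^ 2 = ‖x - proj S x‖ ^ 2 - 2 * inner ℝ (x - proj S x) (z - proj S x)
      + ‖z - proj S x‖ ^ 2 := by
    rw [← norm_sub_sq_real]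
    congr 2
    abel
  rw [norm_sub_rev (proj S x) z, norm_sub_rev (proj S x) x]
  linarith

theorem norm_proj_sub_proj_le (hS : IsClosed S) (hc : Convex ℝ S) (hne : S.Nonempty)
    (x y : EuclideanSpace ℝ (Fin d)) : ‖proj S x - proj S y‖ ≤ ‖x - y‖ := by
  have h1 := inner_sub_proj_nonpos hS hc hne x (proj_mem hS hne y)
  have h2 := inner_sub_proj_nonpos hS hc hne y (proj_mem hS hne x)
  have e : ‖proj S x - proj S y‖ ^ 2 = inner ℝ (x - y) (proj S x - proj S y)
      + inner ℝ (x - proj S x) (proj S y - proj S x)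
      + inner ℝ (y - proj S y) (proj S x - proj S y) := by
    rw [← real_inner_self_eq_norm_sq, ← neg_sub (proj S x) (proj S y), inner_neg_right,
      ← sub_eq_add_neg, ← inner_sub_left, ← inner_add_left]
    congr 1
    abel
  have h3 := real_inner_le_norm (x - y) (proj S x - proj S y)
  by_contra! hlt
  nlinarith [norm_nonneg (proj S x - proj S y), norm_nonneg (x - y)]

/-- The squared distance to a closed convex set is differentiable, with gradient
`2 (x - proj S x)`. -/
theorem abs_infDist_sq_sub_le (hS : IsClosed S) (hc : Convex ℝ S) (hne : S.Nonempty)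
    (x h : EuclideanSpace ℝ (Fin d)) :
    |Metric.infDist (x + h) S ^ 2 - Metric.infDist x S ^ 2 - 2 * inner ℝ (x - proj S x) h|
      ≤ 3 * ‖h‖ ^ 2 := by
  -- The upper bound measures the distance from `y + k` to the projection of `y`. The lower bound is
  -- the same inequality from `x + h` back to `x`, with nonexpansiveness controlling the change of
  -- projection.
  have key : ∀ y k : EuclideanSpace ℝ (Fin d), Metric.infDist (y + k) S ^ 2
      ≤ Metric.infDist y S ^ 2 + 2 * inner ℝ (y - proj S y) k + ‖k‖ ^ 2 := by
    intro y k
    rw [infDist_eq_norm_sub_proj hS hne y, ← norm_add_sq_real]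
    refine pow_le_pow_left₀ Metric.infDist_nonneg ?_ 2
    have := Metric.infDist_le_dist_of_mem (x := y + k) (proj_mem hS hne y)
    rwa [dist_eq_norm, add_sub_right_comm] at this
  have h1 := key x h
  have h2 := key (x + h) (-h)
  rw [add_neg_cancel_right, inner_neg_right, norm_neg] at h2
  have e : inner ℝ (x + h - proj S (x + h)) h = inner ℝ (x - proj S x) h + ‖h‖ ^ 2
      - inner ℝ (proj S (x + h) - proj S x) h := by
    rw [← real_inner_self_eq_norm_sq, ← inner_add_left, ← inner_sub_left]
    congr 1
    abel
  have h3 := abs_real_inner_le_norm (proj S (x + h) - proj S x) h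
  have h4 := norm_proj_sub_proj_le hS hc hne (x + h) x
  rw [add_sub_cancel_left] at h4
  have h5 : |inner ℝ (proj S (x + h) - proj S x) h| ≤ ‖h‖ ^ 2 := by
    nlinarith [norm_nonneg h]
  rw [abs_le] at h5 ⊢
  constructor <;> nlinarith [sq_nonneg ‖h‖, h5.1, h5.2]

theorem tendsto_infDist_sq_slope (hS : IsClosed S) (hc : Convex ℝ S) (hne : S.Nonempty)
    (x e : EuclideanSpace ℝ (Fin d)) :
    Tendsto (fun n : ℕ => ((n : ℝ) + 1) / 2 *
      (Metric.infDist (x + (1 / ((n : ℝ) + 1)) • e) S ^ 2 - Metric.infDist x S ^ 2))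
      atTop (𝓝 (inner ℝ (x - proj S x) e)) := by
  have hz : Tendsto (fun n : ℕ => 3 / 2 * ‖e‖ ^ 2 * (1 / ((n : ℝ) + 1))) atTop (𝓝 0) := by
    simpa using (tendsto_one_div_add_atTop_nhds_zero_nat (𝕜 := ℝ)).const_mul (3 / 2 * ‖e‖ ^ 2)
  refine tendsto_iff_norm_sub_tendsto_zero.2
    (squeeze_zero (fun _ => norm_nonneg _) (fun n => ?_) hz)
  have hn : (0 : ℝ) < (n : ℝ) + 1 := by positivity
  have := abs_infDist_sq_sub_le hS hc hne x ((1 / ((n : ℝ) + 1)) • e)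
  rw [inner_smul_right, norm_smul, Real.norm_of_nonneg (by positivity)] at this
  rw [Real.norm_eq_abs]
  have e1 : ((n : ℝ) + 1) / 2 * (Metric.infDist (x + (1 / ((n : ℝ) + 1)) • e) S ^ 2
        - Metric.infDist x S ^ 2) - inner ℝ (x - proj S x) e
      = ((n : ℝ) + 1) / 2 * (Metric.infDist (x + (1 / ((n : ℝ) + 1)) • e) S ^ 2
        - Metric.infDist x S ^ 2
        - 2 * (1 / ((n : ℝ) + 1) * inner ℝ (x - proj S x) e)) := by
    field_simp
  rw [e1, abs_mul, abs_of_nonneg (by positivity)]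
  calc _ ≤ ((n : ℝ) + 1) / 2 * (3 * (1 / ((n : ℝ) + 1) * ‖e‖) ^ 2) := by gcongr
    _ = _ := by field_simp

theorem measurable_infDist_family {α : Type*} [MeasurableSpace α]
    {C : α → Set (EuclideanSpace ℝ (Fin d))}
    (hmeas : ∀ x, Measurable fun j => Metric.infDist x (C j)) :
    Measurable fun p : α × EuclideanSpace ℝ (Fin d) => Metric.infDist p.2 (C p.1) := by
  have h := measurable_uncurry_of_continuous_of_measurable
    (u := fun (x : EuclideanSpace ℝ (Fin d)) (j : α) => Metric.infDist x (C j))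
    (fun _ => Metric.continuous_infDist_pt _) hmeas
  have h2 := h.comp (measurable_swap (α := α) (β := EuclideanSpace ℝ (Fin d)))
  simpa only [Function.comp_def, Function.uncurry_def, Prod.fst_swap, Prod.snd_swap] using h2

/-- The dependence of the sets on the index is known only through distances. Half the gradient of
the squared distance is `x - proj S x`, so each coordinate of the projection is a limit of
difference quotients of measurable distance functions. -/
theorem measurable_proj {α : Type*} [MeasurableSpace α]
    {C : α → Set (EuclideanSpace ℝ (Fin d))} (hC : ∀ j, IsClosed (C j))
    (hconv : ∀ j, Convex ℝ (C j)) (hne : ∀ j, (C j).Nonempty)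
    (hmeas : ∀ x, Measurable fun j => Metric.infDist x (C j)) :
    Measurable fun p : α × EuclideanSpace ℝ (Fin d) => proj (C p.1) p.2 := by
  have hD := measurable_infDist_family hmeas
  have hinner : ∀ e : EuclideanSpace ℝ (Fin d),
      Measurable fun p : α × EuclideanSpace ℝ (Fin d) =>
        (inner ℝ (p.2 - proj (C p.1) p.2) e : ℝ) := by
    intro e
    have hn : ∀ n : ℕ, Measurable fun p : α × EuclideanSpace ℝ (Fin d) =>
        ((n : ℝ) + 1) / 2 * (Metric.infDist (p.2 + (1 / ((n : ℝ) + 1)) • e) (C p.1) ^ 2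
          - Metric.infDist p.2 (C p.1) ^ 2) := by
      intro n
      have h1 : Measurable fun p : α × EuclideanSpace ℝ (Fin d) =>
          Metric.infDist (p.2 + (1 / ((n : ℝ) + 1)) • e) (C p.1) := by
        have h2 : Measurable fun p : α × EuclideanSpace ℝ (Fin d) =>
            (p.1, p.2 + (1 / ((n : ℝ) + 1)) • e) := by fun_prop
        have h3 := hD.comp h2
        simpa only [Function.comp_def] using h3
      exact ((h1.pow_const 2).sub (hD.pow_const 2)).const_mul _
    exact measurable_of_tendsto_metrizable hn (tendsto_pi_nhds.2 fun p =>
      tendsto_infDist_sq_slope (hC p.1) (hconv p.1) (hne p.1) p.2 e)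
  have hcoord : ∀ l, Measurable fun p : α × EuclideanSpace ℝ (Fin d) => proj (C p.1) p.2 l := by
    intro l
    have heq : (fun p : α × EuclideanSpace ℝ (Fin d) => proj (C p.1) p.2 l)
        = fun p => p.2 l - inner ℝ (p.2 - proj (C p.1) p.2) (EuclideanSpace.single l 1) := by
      funext p
      simp [EuclideanSpace.inner_single_right]
    rw [heq]
    exact (((EuclideanSpace.proj (𝕜 := ℝ) l).continuous.measurable).comp measurable_snd).sub
      (hinner _)
  exact (PiLp.continuous_toLp 2 _).measurable.comp (measurable_pi_lambda _ hcoord)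

end Projection

theorem inner_gradient_le_sub {F : Type*} [NormedAddCommGroup F] [InnerProductSpace ℝ F]
    [CompleteSpace F] {f : F → ℝ} (hf : ConvexOn ℝ Set.univ f) (hd : Differentiable ℝ f)
    (x y : F) : inner ℝ (gradient f x) (y - x) ≤ f y - f x := by
  have hconv : ConvexOn ℝ Set.univ fun t : ℝ => f (AffineMap.lineMap x y t) :=
    hf.comp_affineMap (AffineMap.lineMap x y : ℝ →ᵃ[ℝ] F)
  have hder : HasDerivAt (fun t : ℝ => f (AffineMap.lineMap x y t))
      (inner ℝ (gradient f x) (y - x)) 0 := by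
    have h1 : HasDerivAt (fun t : ℝ => (AffineMap.lineMap x y t : F)) (y - x) 0 :=
      AffineMap.hasDerivAt_lineMap
    have h2 : HasFDerivAt f (fderiv ℝ f x) (AffineMap.lineMap x y (0 : ℝ)) := by
      rw [AffineMap.lineMap_apply_zero]
      exact (hd x).hasFDerivAt
    have := h2.comp_hasDerivAt (0 : ℝ) h1
    rwa [← inner_gradient_left] at this
  have := hconv.le_slope_of_hasDerivAt (Set.mem_univ 0) (Set.mem_univ 1) one_pos hder
  simpa [slope_def_field] using this

/-- The number of updates of agent `i` during the first `k` ticks. -/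
def updateCount {m : ℕ} (g : ℕ → Fin m × Fin m) (i : Fin m) (k : ℕ) : ℕ :=
  ((Finset.range k).filter fun t => i = (g t).1 ∨ i = (g t).2).card

/-- The estimates after agents `i` and `j` have averaged their estimates and each has made a
projected gradient step with stepsizes `a` and constraint samples `w`. -/
noncomputable def edgeStep {m d : ℕ} {ι : Fin m → Type*}
    (f : Fin m → EuclideanSpace ℝ (Fin d) → ℝ)
    (C : ∀ i, ι i → Set (EuclideanSpace ℝ (Fin d))) (a : Fin m → ℝ) (i j : Fin m)
    (w : ∀ i, ι i) (x : Fin m → EuclideanSpace ℝ (Fin d)) :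
    Fin m → EuclideanSpace ℝ (Fin d) :=
  fun l => if l = i ∨ l = j then
    proj (C l (w l)) (midpoint ℝ (x i) (x j) - a l • gradient (f l) (midpoint ℝ (x i) (x j)))
  else x l

/-! ### Deterministic estimates for one gossip step -/

section EdgeStep

variable {m d : ℕ} {ι : Fin m → Type*}

theorem mix_gossipMatrix (i j : Fin m) (x : Fin m → EuclideanSpace ℝ (Fin d)) (l : Fin m) :
    mix (gossipMatrix i j) x l = if l = i ∨ l = j then midpoint ℝ (x i) (x j) else x l := by
  have h : mix (gossipMatrix i j) x l = x l - (1 / 2 : ℝ) •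
      (((Pi.single i (1 : ℝ) - Pi.single j 1 : Fin m → ℝ) l) • (x i - x j)) := by
    simp only [mix, gossipMatrix, Matrix.sub_apply, Matrix.smul_apply, Matrix.vecMulVec_apply,
      sub_smul, Finset.sum_sub_distrib, Matrix.one_apply, ite_smul, one_smul, zero_smul,
      Finset.sum_ite_eq, Finset.mem_univ, if_true, smul_eq_mul, mul_smul]
    rw [← Finset.smul_sum, ← Finset.smul_sum]
    simp only [Pi.sub_apply, sub_smul, Finset.sum_sub_distrib, Pi.single_apply, ite_smul,
      one_smul, zero_smul, Finset.sum_ite_eq', Finset.mem_univ, if_true]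
  rw [h, midpoint_eq_smul_add, invOf_eq_inv]
  simp only [Pi.sub_apply, Pi.single_apply]
  by_cases h1 : l = i <;> by_cases h2 : l = j
  · subst h1; subst h2; simp [← two_smul ℝ (x l), smul_smul]
  · subst h1; simp [h2]; module
  · subst h2; simp [h1]; module
  · simp [h1, h2]

/-- Counting only the earlier ticks makes the stepsize known before the tick. The `+ 1` is the
current update; for idle agents the stepsize is irrelevant. -/
theorem iterate_succ_eq_edgeStep (f : Fin m → EuclideanSpace ℝ (Fin d) → ℝ)
    (C : ∀ i, ι i → Set (EuclideanSpace ℝ (Fin d))) (x₀ : Fin m → EuclideanSpace ℝ (Fin d))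
    (g : ℕ → Fin m × Fin m) (w : ℕ → ∀ i, ι i) (k : ℕ) :
    iterate f C x₀ g w (k + 1) = edgeStep f C (fun l => 1 / ((updateCount g l k : ℝ) + 1))
      (g k).1 (g k).2 (w k) (iterate f C x₀ g w k) := by
  funext l
  simp only [iterate, edgeStep, mix_gossipMatrix]
  by_cases h : l = (g k).1 ∨ l = (g k).2
  · have : numUpdates g l k = updateCount g l k + 1 := by
      rw [numUpdates, updateCount, Finset.range_add_one, Finset.filter_insert, if_pos h,
        Finset.card_insert_of_notMem (by simp)]
    simp only [h, if_true, this]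
    push_cast
    abel
  · simp [h]

/-- The effect of one projected gradient step on the squared distance to a feasible point. -/
theorem norm_proj_gradient_step_sq_le {f : EuclideanSpace ℝ (Fin d) → ℝ}
    (hf : ConvexOn ℝ Set.univ f) (hfd : Differentiable ℝ f)
    {S X : Set (EuclideanSpace ℝ (Fin d))} (hS : IsClosed S) (hSc : Convex ℝ S)
    (hX : IsClosed X) (hXc : Convex ℝ X) (hXS : X ⊆ S) {B L c θ a : ℝ}
    (hB : ∀ x ∈ X, ‖gradient f x‖ ≤ B)
    (hL : ∀ x y, ‖gradient f x - gradient f y‖ ≤ L * ‖x - y‖)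
    (hc : 0 < c) (hθ : 0 < θ) (ha : 0 ≤ a) {y : EuclideanSpace ℝ (Fin d)} (hy : y ∈ X)
    (v u : EuclideanSpace ℝ (Fin d)) :
    ‖proj S (v - a • gradient f v) - y‖ ^ 2 ≤ ‖v - y‖ ^ 2 - 2 * (a * (f (proj X u) - f y))
      - 3 / 4 * Metric.infDist v S ^ 2 + Metric.infDist v X ^ 2 / (4 * c) + θ * ‖v - u‖ ^ 2
      + (4 * c * B ^ 2 + B ^ 2 / θ + 8 * B ^ 2 + 8 * L ^ 2) * a ^ 2 * (1 + ‖v - y‖ ^ 2) := by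
  set p := proj S (v - a • gradient f v) with hp
  set n := gradient f v with hn
  have hB0 : 0 ≤ B := (norm_nonneg _).trans (hB y hy)
  have h1 := norm_proj_sub_sq_le hS hSc (v - a • n) (hXS hy)
  rw [← hp] at h1
  have e1 : ‖v - a • n - y‖ ^ 2 = ‖v - y‖ ^ 2 - 2 * (a * inner ℝ n (v - y)) + ‖a • n‖ ^ 2 := by
    rw [show v - a • n - y = (v - y) - a • n by abel, norm_sub_sq_real, inner_smul_right,
      real_inner_comm]
  have e2 : ‖p - (v - a • n)‖ ^ 2 = ‖p - v‖ ^ 2 + 2 * inner ℝ (p - v) (a • n) + ‖a • n‖ ^ 2 := by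
    rw [← norm_add_sq_real]
    congr 2
    abel
  have h2 : Metric.infDist v S ≤ ‖p - v‖ := by
    rw [norm_sub_rev, ← dist_eq_norm]
    exact Metric.infDist_le_dist_of_mem (proj_mem hS ⟨y, hXS hy⟩ _)
  -- Young's inequality spends a quarter of `‖p - v‖ ^ 2`, which leaves the coefficient `3 / 4`.
  have h3 : -(2 * inner ℝ (p - v) (a • n)) ≤ ‖p - v‖ ^ 2 / 4 + 4 * (a ^ 2 * ‖n‖ ^ 2) := by
    have := abs_le.1 (abs_real_inner_le_norm (p - v) (a • n))
    rw [norm_smul, Real.norm_of_nonneg ha] at this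
    nlinarith [sq_nonneg (‖p - v‖ / 2 - 2 * (a * ‖n‖)), this.1]
  -- The gradient is bounded only on `X`; elsewhere the Lipschitz condition gives linear growth,
  -- hence the factor `1 + ‖v - y‖ ^ 2` in the error.
  have h4 : ‖n‖ ≤ B + L * ‖v - y‖ := by
    have := norm_add_le (n - gradient f y) (gradient f y)
    rw [sub_add_cancel] at this
    linarith [hL v y, hB y hy]
  have h5 : ‖n‖ ^ 2 ≤ 2 * B ^ 2 + 2 * (L ^ 2 * ‖v - y‖ ^ 2) := by
    have := pow_le_pow_left₀ (norm_nonneg n) h4 2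
    nlinarith [sq_nonneg (B - L * ‖v - y‖)]
  have h6 : f v - f y ≤ inner ℝ n (v - y) := by
    have := inner_gradient_le_sub hf hfd v y
    rw [← neg_sub v y, inner_neg_right] at this
    linarith
  have hne : X.Nonempty := ⟨y, hy⟩
  have h7 : ‖v - proj X u‖ ≤ Metric.infDist v X + ‖v - u‖ := by
    rw [infDist_eq_norm_sub_proj hX hne v]
    have := norm_add_le (v - proj X v) (proj X v - proj X u)
    rw [sub_add_sub_cancel] at this
    exact this.trans (by gcongr; exact norm_proj_sub_proj_le hX hXc hne v u)
  -- Linearizing at `proj X u`, a point of `X`, allows the bound `B` to be used.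
  have h8 : f (proj X u) - B * (Metric.infDist v X + ‖v - u‖) ≤ f v := by
    have h := inner_gradient_le_sub hf hfd (proj X u) v
    have h' := abs_le.1 (abs_real_inner_le_norm (gradient f (proj X u)) (v - proj X u))
    have : ‖gradient f (proj X u)‖ * ‖v - proj X u‖ ≤ B * (Metric.infDist v X + ‖v - u‖) :=
      mul_le_mul (hB _ (proj_mem hX hne u)) h7 (norm_nonneg _) hB0
    linarith [h'.1]
  have h9 : a * (f (proj X u) - f y) - a * B * (Metric.infDist v X + ‖v - u‖)
      ≤ a * inner ℝ n (v - y) := by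
    have := mul_le_mul_of_nonneg_left (show f (proj X u) - f y
      - B * (Metric.infDist v X + ‖v - u‖) ≤ inner ℝ n (v - y) by linarith) ha
    linarith
  -- The Young weights differ on purpose: `1 / (4 * c)` is a third of what regularity returns from
  -- the `3 / 4` term, and `θ` stays free so that the disagreement term can be absorbed later.
  have h10 : 2 * (a * B * Metric.infDist v X)
      ≤ 4 * c * B ^ 2 * a ^ 2 + Metric.infDist v X ^ 2 / (4 * c) := by
    have : 0 ≤ (4 * c * (a * B) - Metric.infDist v X) ^ 2 / (4 * c) := by positivity
    have e : (4 * c * (a * B) - Metric.infDist v X) ^ 2 / (4 * c)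
        = 4 * c * B ^ 2 * a ^ 2 + Metric.infDist v X ^ 2 / (4 * c)
          - 2 * (a * B * Metric.infDist v X) := by
      field_simp
      ring
    linarith
  have h11 : 2 * (a * B * ‖v - u‖) ≤ B ^ 2 / θ * a ^ 2 + θ * ‖v - u‖ ^ 2 := by
    have : 0 ≤ (a * B - θ * ‖v - u‖) ^ 2 / θ := by positivity
    have e : (a * B - θ * ‖v - u‖) ^ 2 / θ = B ^ 2 / θ * a ^ 2 + θ * ‖v - u‖ ^ 2
        - 2 * (a * B * ‖v - u‖) := by
      field_simp
      ring
    linarith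
  have h12 : Metric.infDist v S ^ 2 ≤ ‖p - v‖ ^ 2 :=
    pow_le_pow_left₀ Metric.infDist_nonneg h2 2
  have h13 := mul_le_mul_of_nonneg_left h5 (sq_nonneg a)
  have h14 : 0 ≤ (4 * c * B ^ 2 + B ^ 2 / θ + 8 * B ^ 2) * a ^ 2 * ‖v - y‖ ^ 2 := by positivity
  have h15 : 0 ≤ 8 * L ^ 2 * a ^ 2 := by positivity
  nlinarith

variable {f : Fin m → EuclideanSpace ℝ (Fin d) → ℝ}
  {C : ∀ i, ι i → Set (EuclideanSpace ℝ (Fin d))}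

/-- This is the parallelogram law; its last term is the gain from averaging that forces consensus.
-/
theorem norm_midpoint_sub_sq (x y z : EuclideanSpace ℝ (Fin d)) :
    2 * ‖midpoint ℝ x y - z‖ ^ 2 = ‖x - z‖ ^ 2 + ‖y - z‖ ^ 2 - 1 / 2 * ‖x - y‖ ^ 2 := by
  have h := parallelogram_law_with_norm ℝ (x - z) (y - z)
  rw [sub_sub_sub_cancel_right] at h
  have e : x - z + (y - z) = (2 : ℝ) • (midpoint ℝ x y - z) := by
    rw [midpoint_eq_smul_add, invOf_eq_inv]
    module
  rw [e, norm_smul, Real.norm_of_nonneg zero_le_two] at h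
  nlinarith

theorem norm_midpoint_sub_sq_le_sum (x : Fin m → EuclideanSpace ℝ (Fin d)) (i j : Fin m)
    (z : EuclideanSpace ℝ (Fin d)) :
    ‖midpoint ℝ (x i) (x j) - z‖ ^ 2 ≤ ∑ l, ‖x l - z‖ ^ 2 := by
  have h := norm_midpoint_sub_sq (x i) (x j) z
  have h1 : ∀ l, ‖x l - z‖ ^ 2 ≤ ∑ l, ‖x l - z‖ ^ 2 := fun l =>
    Finset.single_le_sum (f := fun l => ‖x l - z‖ ^ 2) (fun _ _ => sq_nonneg _)
      (Finset.mem_univ l)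
  nlinarith [h1 i, h1 j, sq_nonneg ‖x i - x j‖]

theorem isClosed_feasibleSet (hC : ∀ i j, IsClosed (C i j)) : IsClosed (feasibleSet C) :=
  isClosed_iInter fun i => isClosed_iInter fun j => hC i j

theorem convex_feasibleSet (hC : ∀ i j, Convex ℝ (C i j)) : Convex ℝ (feasibleSet C) :=
  convex_iInter fun i => convex_iInter fun j => hC i j

theorem feasibleSet_subset (i : Fin m) (j : ι i) : feasibleSet C ⊆ C i j :=
  (Set.iInter_subset _ i).trans (Set.iInter_subset _ j)

/-- Idle agents cancel, and the single-agent estimates of the two distinct ends add up, which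
doubles `1 / (4 * c)` and `θ`. The reference agent `r` is the same for both ends. -/
theorem sum_norm_edgeStep_sub_sq_le
    (hCc : ∀ i j, IsClosed (C i j)) (hCv : ∀ i j, Convex ℝ (C i j))
    (hf : ∀ i, ConvexOn ℝ Set.univ (f i)) (hfd : ∀ i, Differentiable ℝ (f i)) {B L c θ : ℝ}
    (hB : ∀ i, ∀ x ∈ feasibleSet C, ‖gradient (f i) x‖ ≤ B)
    (hL : ∀ i x y, ‖gradient (f i) x - gradient (f i) y‖ ≤ L * ‖x - y‖)
    (hc : 0 < c) (hθ : 0 < θ) {a : Fin m → ℝ} (ha : ∀ l, 0 ≤ a l)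
    {y : EuclideanSpace ℝ (Fin d)} (hy : y ∈ feasibleSet C) {i j : Fin m} (hij : i ≠ j)
    (r : Fin m) (w : ∀ i, ι i) (x : Fin m → EuclideanSpace ℝ (Fin d)) :
    ∑ l, ‖edgeStep f C a i j w x l - y‖ ^ 2 ≤ ∑ l, ‖x l - y‖ ^ 2 - 1 / 2 * ‖x i - x j‖ ^ 2
      - 2 * (a i * (f i (proj (feasibleSet C) (x r)) - f i y)
        + a j * (f j (proj (feasibleSet C) (x r)) - f j y))
      - 3 / 4 * (Metric.infDist (midpoint ℝ (x i) (x j)) (C i (w i)) ^ 2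
        + Metric.infDist (midpoint ℝ (x i) (x j)) (C j (w j)) ^ 2)
      + Metric.infDist (midpoint ℝ (x i) (x j)) (feasibleSet C) ^ 2 / (2 * c)
      + 2 * θ * ∑ l, ‖x l - x r‖ ^ 2
      + (4 * c * B ^ 2 + B ^ 2 / θ + 8 * B ^ 2 + 8 * L ^ 2) * (a i ^ 2 + a j ^ 2)
        * (1 + ∑ l, ‖x l - y‖ ^ 2) := by
  set X := feasibleSet C
  set v := midpoint ℝ (x i) (x j) with hv
  have hX : IsClosed X := isClosed_feasibleSet hCc
  have hXc : Convex ℝ X := convex_feasibleSet hCv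
  have e : ∑ l, (‖edgeStep f C a i j w x l - y‖ ^ 2 - ‖x l - y‖ ^ 2)
      = (‖edgeStep f C a i j w x i - y‖ ^ 2 - ‖x i - y‖ ^ 2)
        + (‖edgeStep f C a i j w x j - y‖ ^ 2 - ‖x j - y‖ ^ 2) :=
    Fintype.sum_eq_add i j hij fun l hl => by simp [edgeStep, hl.1, hl.2]
  rw [Finset.sum_sub_distrib] at e
  have hstep : ∀ l, l = i ∨ l = j → ‖edgeStep f C a i j w x l - y‖ ^ 2 ≤ _ := fun l hl => by
    simp only [edgeStep, hl, if_true]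
    exact norm_proj_gradient_step_sq_le (hf l) (hfd l) (hCc l (w l)) (hCv l (w l)) hX hXc
      (feasibleSet_subset l (w l)) (hB l) (hL l) hc hθ (ha l) hy v (x r)
  have hi := hstep i (Or.inl rfl)
  have hj := hstep j (Or.inr rfl)
  have hp := norm_midpoint_sub_sq (x i) (x j) y
  rw [← hv] at hp
  have hV := norm_midpoint_sub_sq_le_sum x i j y
  have hR := norm_midpoint_sub_sq_le_sum x i j (x r)
  rw [← hv] at hV hR
  have hK : 0 ≤ 4 * c * B ^ 2 + B ^ 2 / θ + 8 * B ^ 2 + 8 * L ^ 2 := by positivity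
  have hKi := mul_le_mul_of_nonneg_left (add_le_add_right hV 1) (mul_nonneg hK (sq_nonneg (a i)))
  have hKj := mul_le_mul_of_nonneg_left (add_le_add_right hV 1) (mul_nonneg hK (sq_nonneg (a j)))
  have hRθ := mul_le_mul_of_nonneg_left hR hθ.le
  have e2 : Metric.infDist v X ^ 2 / (2 * c) = Metric.infDist v X ^ 2 / (4 * c)
      + Metric.infDist v X ^ 2 / (4 * c) := by
    field_simp
    ring
  rw [e2]
  linarith

/-- In a connected network the disagreement with one agent is controlled by the weighted
disagreement along the edges. -/
theorem exists_sum_norm_sub_sq_le {G : SimpleGraph (Fin m)} (hG : G.Connected)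
    {q : Fin m → Fin m → ℝ} (hq : ∀ i j, 0 ≤ q i j) (hqpos : ∀ i j, G.Adj i j → 0 < q i j)
    (r : Fin m) : ∃ κ : ℝ, 0 < κ ∧ ∀ x : Fin m → EuclideanSpace ℝ (Fin d),
      ∑ l, ‖x l - x r‖ ^ 2 ≤ κ * ∑ i, ∑ j, q i j * ‖x i - x j‖ ^ 2 := by
  have hnn : ∀ x : Fin m → EuclideanSpace ℝ (Fin d),
      0 ≤ ∑ i, ∑ j, q i j * ‖x i - x j‖ ^ 2 := fun x =>
    Finset.sum_nonneg fun i _ => Finset.sum_nonneg fun j _ => mul_nonneg (hq i j) (sq_nonneg _)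
  -- Induction along a walk to `r`: each edge `u v` costs a factor `(q u v)⁻¹`, and squaring the
  -- triangle inequality doubles the constants.
  have hwalk : ∀ l, ∀ p : G.Walk l r, ∃ κ : ℝ, 0 ≤ κ ∧
      ∀ x : Fin m → EuclideanSpace ℝ (Fin d),
        ‖x l - x r‖ ^ 2 ≤ κ * ∑ i, ∑ j, q i j * ‖x i - x j‖ ^ 2 := by
    intro l p
    induction p with
    | nil => exact ⟨0, le_rfl, fun x => by simp⟩
    | @cons u v w h p ih =>
      obtain ⟨κ, hκ, hk⟩ := ih
      refine ⟨2 * κ + 2 * (q u v)⁻¹, by have := hqpos u v h; positivity, fun x => ?_⟩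
      have h1 : q u v * ‖x u - x v‖ ^ 2 ≤ ∑ i, ∑ j, q i j * ‖x i - x j‖ ^ 2 :=
        (Finset.single_le_sum (f := fun j => q u j * ‖x u - x j‖ ^ 2)
          (fun j _ => mul_nonneg (hq u j) (sq_nonneg _)) (Finset.mem_univ v)).trans
        (Finset.single_le_sum (f := fun i => ∑ j, q i j * ‖x i - x j‖ ^ 2)
          (fun i _ => Finset.sum_nonneg fun j _ => mul_nonneg (hq i j) (sq_nonneg _))
          (Finset.mem_univ u))
      have h2 : ‖x u - x v‖ ^ 2 ≤ (q u v)⁻¹ * ∑ i, ∑ j, q i j * ‖x i - x j‖ ^ 2 := by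
        rw [inv_mul_eq_div, le_div_iff₀ (hqpos u v h)]
        linarith
      have h3 : ‖x u - x w‖ ≤ ‖x u - x v‖ + ‖x v - x w‖ := norm_sub_le_norm_sub_add_norm_sub ..
      have h4 := pow_le_pow_left₀ (norm_nonneg _) h3 2
      nlinarith [hk x, sq_nonneg (‖x u - x v‖ - ‖x v - x w‖)]
  choose κ hκ hk using fun l => hwalk l (hG.preconnected l r).some
  -- The `+ 1` keeps the constant positive when all `κ l` vanish, as for a single agent.
  refine ⟨∑ l, κ l + 1, add_pos_of_nonneg_of_pos (Finset.sum_nonneg fun l _ => hκ l) one_pos,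
    fun x => ?_⟩
  calc ∑ l, ‖x l - x r‖ ^ 2 ≤ ∑ l, κ l * ∑ i, ∑ j, q i j * ‖x i - x j‖ ^ 2 :=
        Finset.sum_le_sum fun l _ => hk l x
    _ ≤ _ := by
        rw [← Finset.sum_mul]
        exact mul_le_mul_of_nonneg_right (by linarith) (hnn x)

/-- With zero diagonal, `∑ j, (q l j + q j l)` is the probability that agent `l` takes part in a
tick. -/
theorem sum_sum_mul_add (q : Fin m → Fin m → ℝ) (h : Fin m → ℝ) :
    ∑ i, ∑ j, q i j * (h i + h j) = ∑ l, (∑ j, (q l j + q j l)) * h l := by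
  simp only [mul_add, Finset.sum_add_distrib, add_mul, Finset.sum_mul]
  rw [Finset.sum_comm (f := fun i j => q i j * h j)]

/-- By convexity the gradients at the two end points suffice; nothing is needed on the segment
between them. -/
theorem abs_sub_le_of_gradient_le {φ : EuclideanSpace ℝ (Fin d) → ℝ}
    (hf : ConvexOn ℝ Set.univ φ) (hfd : Differentiable ℝ φ) {B : ℝ}
    {x y : EuclideanSpace ℝ (Fin d)} (hx : ‖gradient φ x‖ ≤ B) (hy : ‖gradient φ y‖ ≤ B) :
    |φ x - φ y| ≤ B * ‖x - y‖ := by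
  have h1 := inner_gradient_le_sub hf hfd x y
  have h2 := inner_gradient_le_sub hf hfd y x
  have h3 := abs_le.1 (abs_real_inner_le_norm (gradient φ x) (y - x))
  have h4 := abs_le.1 (abs_real_inner_le_norm (gradient φ y) (x - y))
  have h5 : ‖gradient φ x‖ * ‖y - x‖ ≤ B * ‖x - y‖ := by
    rw [norm_sub_rev y x]
    gcongr
  have h6 : ‖gradient φ y‖ * ‖x - y‖ ≤ B * ‖x - y‖ := by gcongr
  exact abs_le.2 ⟨by linarith [h4.1], by linarith [h3.1]⟩

/-- Averaging the one-step estimates over the random edge. -/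
theorem sum_edge_estimate_le
    (hCc : ∀ i j, IsClosed (C i j)) (hCv : ∀ i j, Convex ℝ (C i j))
    (hf : ∀ i, ConvexOn ℝ Set.univ (f i)) (hfd : ∀ i, Differentiable ℝ (f i)) {B c θ κ K b : ℝ}
    (hB : ∀ i, ∀ x ∈ feasibleSet C, ‖gradient (f i) x‖ ≤ B)
    {q : Fin m → Fin m → ℝ} (hq1 : ∑ i, ∑ j, q i j = 1)
    (hθ : θ = 1 / (8 * κ)) (hκ : 0 < κ) (r : Fin m) (x : Fin m → EuclideanSpace ℝ (Fin d))
    (hκr : ∑ l, ‖x l - x r‖ ^ 2 ≤ κ * ∑ i, ∑ j, q i j * ‖x i - x j‖ ^ 2)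
    (a : Fin m → ℝ) {y : EuclideanSpace ℝ (Fin d)} (hy : y ∈ feasibleSet C) :
    ∑ i, ∑ j, q i j * (∑ l, ‖x l - y‖ ^ 2 - 1 / 2 * ‖x i - x j‖ ^ 2
      - 2 * (a i * (f i (proj (feasibleSet C) (x r)) - f i y)
        + a j * (f j (proj (feasibleSet C) (x r)) - f j y))
      - 1 / c * Metric.infDist (midpoint ℝ (x i) (x j)) (feasibleSet C) ^ 2
      + 2 * θ * ∑ l, ‖x l - x r‖ ^ 2
      + K * (a i ^ 2 + a j ^ 2) * (1 + ∑ l, ‖x l - y‖ ^ 2))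
    ≤ (1 + (K * ∑ l, (∑ j, (q l j + q j l)) * a l ^ 2
        + 2 * B * ∑ l, |(∑ j, (q l j + q j l)) * a l - b|)) * (1 + ∑ l, ‖x l - y‖ ^ 2) - 1
      - (1 / 4 * ∑ i, ∑ j, q i j * ‖x i - x j‖ ^ 2
        + 1 / c * ∑ i, ∑ j, q i j *
          Metric.infDist (midpoint ℝ (x i) (x j)) (feasibleSet C) ^ 2
        + 2 * b * (objective f (proj (feasibleSet C) (x r)) - objective f y)) := by
  set X := feasibleSet C with hXdef
  have hX : IsClosed X := isClosed_feasibleSet hCc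
  have hXc : Convex ℝ X := convex_feasibleSet hCv
  have hne : X.Nonempty := ⟨y, hy⟩
  set V := ∑ l, ‖x l - y‖ ^ 2 with hV
  set z := proj X (x r)
  set R := ∑ l, ‖x l - x r‖ ^ 2
  obtain ⟨γ, hγ⟩ : ∃ γ : Fin m → ℝ, ∀ l, ∑ j, (q l j + q j l) = γ l := ⟨_, fun _ => rfl⟩
  simp only [hγ]
  have hV0 : 0 ≤ V := Finset.sum_nonneg fun _ _ => sq_nonneg _
  have hB0 : 0 ≤ B := (norm_nonneg _).trans (hB r y hy)
  have e1 : ∀ i j, q i j * (V - 1 / 2 * ‖x i - x j‖ ^ 2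
      - 2 * (a i * (f i z - f i y) + a j * (f j z - f j y))
      - 1 / c * Metric.infDist (midpoint ℝ (x i) (x j)) X ^ 2 + 2 * θ * R
      + K * (a i ^ 2 + a j ^ 2) * (1 + V))
      = (V + 2 * θ * R) * q i j - 1 / 2 * (q i j * ‖x i - x j‖ ^ 2)
        - 2 * (q i j * (a i * (f i z - f i y) + a j * (f j z - f j y)))
        - 1 / c * (q i j * Metric.infDist (midpoint ℝ (x i) (x j)) X ^ 2)
        + K * (1 + V) * (q i j * (a i ^ 2 + a j ^ 2)) := fun i j => by ring
  simp only [e1, Finset.sum_add_distrib, Finset.sum_sub_distrib, ← Finset.mul_sum]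
  rw [hq1, sum_sum_mul_add q fun l => a l * (f l z - f l y), sum_sum_mul_add q fun l => a l ^ 2]
  simp only [hγ]
  have hzy : ‖z - y‖ ≤ 1 + V := by
    have h1 : ‖z - y‖ ^ 2 ≤ ‖x r - y‖ ^ 2 := by
      have := norm_proj_sub_sq_le hX hXc (x r) hy
      nlinarith [sq_nonneg ‖z - x r‖]
    have h2 : ‖x r - y‖ ^ 2 ≤ V := Finset.single_le_sum (f := fun l => ‖x l - y‖ ^ 2)
      (fun _ _ => sq_nonneg _) (Finset.mem_univ r)
    nlinarith [sq_nonneg (‖z - y‖ - 1)]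
  have hδ : ∀ l, |f l z - f l y| ≤ B * (1 + V) := fun l =>
    (abs_sub_le_of_gradient_le (hf l) (hfd l) (hB l z (proj_mem hX hne _)) (hB l y hy)).trans
      (mul_le_mul_of_nonneg_left hzy hB0)
  -- Replacing every `γ l * a l` by the common `b` reassembles the global objective; the deviations
  -- are charged to the growth factor.
  have e2 : ∑ l, γ l * (a l * (f l z - f l y)) = b * (objective f z - objective f y)
      + ∑ l, (γ l * a l - b) * (f l z - f l y) := by
    rw [objective, objective, ← Finset.sum_sub_distrib, Finset.mul_sum, ← Finset.sum_add_distrib]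
    exact Finset.sum_congr rfl fun l _ => by ring
  have h3 : -(∑ l, (γ l * a l - b) * (f l z - f l y))
      ≤ (∑ l, |γ l * a l - b|) * (B * (1 + V)) := by
    rw [← Finset.sum_neg_distrib, Finset.sum_mul]
    refine Finset.sum_le_sum fun l _ => ?_
    calc _ ≤ |(γ l * a l - b) * (f l z - f l y)| := neg_le_abs _
      _ ≤ _ := by
        rw [abs_mul]
        exact mul_le_mul_of_nonneg_left (hδ l) (abs_nonneg _)
  -- The choice `θ = 1 / (8 * κ)` uses up half of the consensus gain `1 / 2` and leaves `1 / 4`.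
  have h4 : 2 * θ * R ≤ 1 / 4 * ∑ i, ∑ j, q i j * ‖x i - x j‖ ^ 2 := by
    have := mul_le_mul_of_nonneg_left hκr (show 0 ≤ 2 * θ by rw [hθ]; positivity)
    refine this.trans_eq ?_
    rw [hθ]
    field_simp
    ring
  rw [e2]
  linarith

end EdgeStep

/-! ### Almost supermartingales -/

section Convergence

variable {S : Type*} {m0 : MeasurableSpace S} {μ : Measure S}

/-- This lets the drift inequality be proved as an inequality of integrals over past events. -/
theorem condExp_le_of_forall_setIntegral_le [IsFiniteMeasure μ] {m : MeasurableSpace S}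
    (hm : m ≤ m0) {f g : S → ℝ} (hf : Integrable f μ) (hg : Integrable g μ)
    (hgm : StronglyMeasurable[m] g)
    (h : ∀ A, MeasurableSet[m] A → ∫ s in A, f s ∂μ ≤ ∫ s in A, g s ∂μ) :
    μ[f | m] ≤ᵐ[μ] g := by
  refine ae_le_of_ae_le_trim (hm := hm) ?_
  refine ae_le_of_forall_setIntegral_le (integrable_condExp.trim hm stronglyMeasurable_condExp)
    (hg.trim hm hgm) fun A hA _ => ?_
  rw [← setIntegral_trim hm stronglyMeasurable_condExp hA, ← setIntegral_trim hm hgm hA,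
    setIntegral_condExp hm hf hA]
  exact h A hA

/-- Nonnegative supermartingales converge almost surely. -/
theorem ae_tendsto_of_nonneg_supermartingale [IsFiniteMeasure μ] {F : Filtration ℕ m0}
    {M : ℕ → S → ℝ} (hM : Supermartingale M F μ) (h0 : ∀ k s, 0 ≤ M k s) :
    ∀ᵐ s ∂μ, ∃ l, Tendsto (fun k => M k s) atTop (𝓝 l) := by
  have hb : ∀ n, eLpNorm ((-M) n) 1 μ ≤ (Real.toNNReal (∫ s, M 0 s ∂μ) : ENNReal) := by
    intro n
    have h1 : ∫ s, M n s ∂μ ≤ ∫ s, M 0 s ∂μ := by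
      have := hM.setIntegral_le (Nat.zero_le n) MeasurableSet.univ
      simpa using this
    rw [Pi.neg_apply, eLpNorm_neg, eLpNorm_one_eq_lintegral_enorm,
      ← ofReal_integral_norm_eq_lintegral_enorm (hM.integrable n)]
    refine ENNReal.ofReal_le_ofReal ?_
    simpa [abs_of_nonneg (h0 n _)] using h1
  filter_upwards [hM.neg.ae_tendsto_limitProcess hb] with s hs
  exact ⟨_, by simpa using hs.neg⟩

/-- The Robbins–Siegmund almost-supermartingale convergence theorem. -/
theorem robbins_siegmund [IsFiniteMeasure μ] {F : Filtration ℕ m0} {W U β : ℕ → S → ℝ}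
    (hW : ∀ k, Measurable[F k] (W k)) (hU : ∀ k, Measurable[F k] (U k))
    (hβ : ∀ k, Measurable[F k] (β k)) (hW0 : ∀ k s, 0 ≤ W k s) (hU0 : ∀ k s, 0 ≤ U k s)
    (hβ0 : ∀ k s, 0 ≤ β k s) (hWi : ∀ k, Integrable (W k) μ) (hUi : ∀ k, Integrable (U k) μ)
    (hβi : ∀ k, Integrable (fun s => β k s * W k s) μ)
    (h : ∀ k A, MeasurableSet[F k] A →
      ∫ s in A, W (k + 1) s ∂μ ≤ ∫ s in A, ((1 + β k s) * W k s - U k s) ∂μ) :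
    ∀ᵐ s ∂μ, Summable (fun k => β k s) →
      (∃ l, Tendsto (fun k => W k s) atTop (𝓝 l)) ∧ Summable fun k => U k s := by
  -- Dividing by this product removes the factors `1 + β`. It runs one step ahead: `Q (k + 1)` is
  -- already known at time `k`, so it can be pulled out of the conditional expectation.
  set Q : ℕ → S → ℝ := fun k s => ∏ t ∈ Finset.range k, (1 + β t s) with hQ
  have hQ1 : ∀ k s, 1 ≤ Q k s := fun k s =>
    Finset.one_le_prod (s := Finset.range k) fun t _ => by linarith [hβ0 t s]
  have hQm : ∀ k, Measurable[F k] (Q (k + 1)) := fun k =>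
    Finset.measurable_fun_prod _ fun t ht => by
      have : Measurable[F k] (β t) :=
        (hβ t).mono (F.mono (Nat.lt_succ_iff.1 (Finset.mem_range.1 ht))) le_rfl
      exact this.const_add 1
  have hQm' : ∀ k, Measurable[F k] (Q k) := fun k =>
    Finset.measurable_fun_prod _ fun t ht => by
      have : Measurable[F k] (β t) :=
        (hβ t).mono (F.mono (Finset.mem_range.1 ht).le) le_rfl
      exact this.const_add 1
  have hQinv : ∀ k s, ‖(Q k s)⁻¹‖ ≤ 1 := fun k s => by
    rw [norm_inv, Real.norm_of_nonneg (by linarith [hQ1 k s])]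
    exact inv_le_one_of_one_le₀ (hQ1 k s)
  have hmul : ∀ k (g : S → ℝ), Integrable g μ → Integrable (fun s => (Q k s)⁻¹ * g s) μ :=
    fun k g hg => hg.bdd_mul
      ((hQm' k).mono (F.le k) le_rfl).inv.aestronglyMeasurable (ae_of_all _ (hQinv k))
  set T : ℕ → S → ℝ := fun k s => ∑ t ∈ Finset.range k, (Q (t + 1) s)⁻¹ * U t s with hT
  have hTm : ∀ k, Measurable[F k] (T (k + 1)) := fun k =>
    Finset.measurable_fun_sum _ fun t ht => by
      have hle := F.mono (Nat.lt_succ_iff.1 (Finset.mem_range.1 ht))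
      exact ((hQm t).mono hle le_rfl).inv.mul ((hU t).mono hle le_rfl)
  have hTm' : ∀ k, Measurable[F k] (T k) := fun k => by
    cases k with
    | zero =>
      have : T 0 = fun _ => 0 := by funext s; simp [hT]
      rw [this]
      exact measurable_const
    | succ k => exact (hTm k).mono (F.mono k.le_succ) le_rfl
  have hTi : ∀ k, Integrable (T k) μ := fun k =>
    integrable_finsetSum _ fun t _ => hmul _ _ (hUi t)
  -- Adding back the discounted decreases `T` keeps `M` a nonnegative supermartingale, so that its
  -- convergence also bounds their sum.
  set M : ℕ → S → ℝ := fun k s => (Q k s)⁻¹ * W k s + T k s with hM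
  have hT0 : ∀ k s, 0 ≤ T k s := fun k s => Finset.sum_nonneg fun t _ =>
    mul_nonneg (inv_nonneg.2 (by linarith [hQ1 (t + 1) s])) (hU0 t s)
  have hsuper : Supermartingale M F μ := by
    refine supermartingale_nat (fun k => ?_) (fun k => (hmul k _ (hWi k)).add (hTi k)) fun k => ?_
    · exact ((hQm' k).inv.mul (hW k)).add (hTm' k) |>.stronglyMeasurable
    · have h1 : μ[W (k + 1) | F k] ≤ᵐ[μ] fun s => (1 + β k s) * W k s - U k s := by
        refine condExp_le_of_forall_setIntegral_le (F.le k) (hWi _) ?_ ?_ (h k)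
        · simp only [add_mul, one_mul]
          exact ((hWi k).add (hβi k)).sub (hUi k)
        · exact ((((hβ k).const_add 1).mul (hW k)).sub (hU k)).stronglyMeasurable
      have h2 : μ[M (k + 1) | F k] =ᵐ[μ] μ[fun s => (Q (k + 1) s)⁻¹ * W (k + 1) s | F k]
          + μ[T (k + 1) | F k] :=
        condExp_add (hmul (k + 1) _ (hWi (k + 1))) (hTi (k + 1)) _
      have h3 : μ[fun s => (Q (k + 1) s)⁻¹ * W (k + 1) s | F k]
          =ᵐ[μ] fun s => (Q (k + 1) s)⁻¹ * μ[W (k + 1) | F k] s :=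
        condExp_mul_of_stronglyMeasurable_left (hQm k).inv.stronglyMeasurable
          (hmul (k + 1) _ (hWi (k + 1))) (hWi (k + 1))
      have h4 : μ[T (k + 1) | F k] = T (k + 1) :=
        condExp_of_stronglyMeasurable (F.le k) (hTm k).stronglyMeasurable (hTi _)
      filter_upwards [h1, h2, h3] with s h1 h2 h3
      rw [h2, Pi.add_apply, h3, h4]
      have hp : 0 < Q k s := by linarith [hQ1 k s]
      have hp' : 0 < 1 + β k s := by linarith [hβ0 k s]
      have e : Q (k + 1) s = Q k s * (1 + β k s) := Finset.prod_range_succ _ _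
      have e' : T (k + 1) s = T k s + (Q (k + 1) s)⁻¹ * U k s := Finset.sum_range_succ _ _
      have e2 : (Q (k + 1) s)⁻¹ * ((1 + β k s) * W k s - U k s) + T (k + 1) s
          = (Q k s)⁻¹ * W k s + T k s := by
        rw [e', e]
        field_simp
        ring
      have := mul_le_mul_of_nonneg_left h1 (show 0 ≤ (Q (k + 1) s)⁻¹ by rw [e]; positivity)
      simp only [hM]
      linarith
  have hM0 : ∀ k s, 0 ≤ M k s := fun k s =>
    add_nonneg (mul_nonneg (inv_nonneg.2 (by linarith [hQ1 k s])) (hW0 k s)) (hT0 k s)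
  filter_upwards [ae_tendsto_of_nonneg_supermartingale hsuper hM0] with s ⟨l, hl⟩ hsum
  -- Summability of `β` first enters here: with `Q` bounded, the limit of `M` passes to `W` and the
  -- discounted sum to `U`.
  have hQb : ∀ k, Q k s ≤ Real.exp (∑' t, β t s) := fun k => by
    calc Q k s ≤ ∏ t ∈ Finset.range k, Real.exp (β t s) :=
          Finset.prod_le_prod (fun t _ => by linarith [hβ0 t s]) fun t _ => by
            linarith [Real.add_one_le_exp (β t s)]
      _ = Real.exp (∑ t ∈ Finset.range k, β t s) := (Real.exp_sum _ _).symm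
      _ ≤ _ := Real.exp_le_exp.2 (hsum.sum_le_tsum _ fun t _ => hβ0 t s)
  have hQmono : Monotone fun k => Q k s := monotone_nat_of_le_succ fun k => by
    change Q k s ≤ Q (k + 1) s
    rw [show Q (k + 1) s = Q k s * (1 + β k s) from Finset.prod_range_succ _ _]
    nlinarith [hQ1 k s, hβ0 k s]
  have hQt := tendsto_atTop_ciSup hQmono
    ⟨Real.exp (∑' t, β t s), by rintro _ ⟨k, rfl⟩; exact hQb k⟩
  obtain ⟨b, hb⟩ := hl.bddAbove_range
  have hTb : ∀ k, T k s ≤ b := fun k => by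
    have h1 : M k s ≤ b := hb ⟨k, rfl⟩
    have h2 : 0 ≤ (Q k s)⁻¹ * W k s :=
      mul_nonneg (inv_nonneg.2 (by linarith [hQ1 k s])) (hW0 k s)
    have : M k s = (Q k s)⁻¹ * W k s + T k s := rfl
    linarith
  have hterm : ∀ t, 0 ≤ (Q (t + 1) s)⁻¹ * U t s := fun t =>
    mul_nonneg (inv_nonneg.2 (by linarith [hQ1 (t + 1) s])) (hU0 t s)
  have hTs : Summable fun t => (Q (t + 1) s)⁻¹ * U t s :=
    summable_of_sum_range_le hterm hTb
  constructor
  · have h1 : Tendsto (fun k => Q k s * (M k s - T k s)) atTop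
        (𝓝 ((⨆ k, Q k s) * (l - ∑' t, (Q (t + 1) s)⁻¹ * U t s))) :=
      hQt.mul (hl.sub hTs.hasSum.tendsto_sum_nat)
    refine ⟨_, h1.congr fun k => ?_⟩
    have : Q k s ≠ 0 := by linarith [hQ1 k s]
    simp only [hM, add_sub_cancel_right]
    field_simp
  · refine Summable.of_nonneg_of_le (fun k => hU0 k s) (fun k => ?_)
      (hTs.mul_left (Real.exp (∑' t, β t s)))
    calc U k s = Q (k + 1) s * ((Q (k + 1) s)⁻¹ * U k s) := by
          have : Q (k + 1) s ≠ 0 := by linarith [hQ1 (k + 1) s]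
          field_simp
      _ ≤ _ := mul_le_mul_of_nonneg_right (hQb _) (hterm k)

end Convergence

/-! ### Conditional expectations and independence -/

section Conditioning

variable {S : Type*} {m0 : MeasurableSpace S} {μ : Measure S}

theorem setIntegral_eq_measureReal_mul_of_indep [IsProbabilityMeasure μ]
    {m1 m2 : MeasurableSpace S}
    (hm1 : m1 ≤ m0) (hm2 : m2 ≤ m0) (hind : Indep m1 m2 μ) {h : S → ℝ}
    (hh : StronglyMeasurable[m1] h) (hi : Integrable h μ) {D : Set S} (hD : MeasurableSet[m2] D) :
    ∫ s in D, h s ∂μ = μ.real D * ∫ s, h s ∂μ := by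
  rw [← setIntegral_condExp hm2 hi hD,
    setIntegral_congr_ae (g := fun _ => ∫ s, h s ∂μ) (hm2 _ hD)
      ((condExp_indep_eq hm1 hm2 hh hind).mono fun s hs _ => hs)]
  simp

/-- Conditioning on additional independent information does not change the conditional
expectation. -/
theorem condExp_sup_of_indep [IsProbabilityMeasure μ] {m1 m2 m3 : MeasurableSpace S}
    (hm13 : m1 ≤ m3) (hm2 : m2 ≤ m0) (hm3 : m3 ≤ m0) (hind : Indep m3 m2 μ) {φ : S → ℝ}
    (hφ : StronglyMeasurable[m3] φ) (hi : Integrable φ μ) :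
    μ[φ | m1] =ᵐ[μ] μ[φ | m1 ⊔ m2] := by
  have hm1 : m1 ≤ m0 := hm13.trans hm3
  have hm12 : m1 ⊔ m2 ≤ m0 := sup_le hm1 hm2
  set p : Set (Set S) := {A | ∃ B D, MeasurableSet[m1] B ∧ MeasurableSet[m2] D ∧ A = B ∩ D}
  have hp : IsPiSystem p := by
    rintro _ ⟨B, D, hB, hD, rfl⟩ _ ⟨B', D', hB', hD', rfl⟩ _
    exact ⟨B ∩ B', D ∩ D', hB.inter hB', hD.inter hD', Set.inter_inter_inter_comm ..⟩
  have hgen : m1 ⊔ m2 = MeasurableSpace.generateFrom p := by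
    refine le_antisymm (sup_le (fun B hB => ?_) fun D hD => ?_)
      (MeasurableSpace.generateFrom_le ?_)
    · exact MeasurableSpace.measurableSet_generateFrom
        ⟨B, Set.univ, hB, MeasurableSet.univ, (Set.inter_univ B).symm⟩
    · exact MeasurableSpace.measurableSet_generateFrom
        ⟨Set.univ, D, MeasurableSet.univ, hD, (Set.univ_inter D).symm⟩
    · rintro _ ⟨B, D, hB, hD, rfl⟩
      exact (le_sup_left (a := m1) (b := m2) _ hB).inter (le_sup_right (a := m1) (b := m2) _ hD)
  have hrect : ∀ B D, MeasurableSet[m1] B → MeasurableSet[m2] D →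
      ∫ s in B ∩ D, (μ[φ | m1]) s ∂μ = ∫ s in B ∩ D, φ s ∂μ := by
    intro B D hB hD
    -- Both `φ` and its conditional expectation are `m3`-measurable, so on a rectangle `B ∩ D` the
    -- same factor `μ.real D` splits off from each.
    have key : ∀ h : S → ℝ, StronglyMeasurable[m3] h → Integrable h μ →
        ∫ s in B ∩ D, h s ∂μ = μ.real D * ∫ s in B, h s ∂μ := by
      intro h hh hhi
      rw [Set.inter_comm, ← setIntegral_indicator (hm1 _ hB),
        setIntegral_eq_measureReal_mul_of_indep hm3 hm2 hind
          (hh.indicator (hm13 _ hB)) (hhi.indicator (hm1 _ hB)) hD,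
        integral_indicator (hm1 _ hB)]
    rw [key _ (stronglyMeasurable_condExp.mono hm13) integrable_condExp, key _ hφ hi,
      setIntegral_condExp hm1 hi hB]
  have hall : ∀ A, MeasurableSet[m1 ⊔ m2] A →
      ∫ s in A, (μ[φ | m1]) s ∂μ = ∫ s in A, φ s ∂μ := by
    refine MeasurableSpace.induction_on_inter hgen hp (by simp) ?_ ?_ ?_
    · rintro _ ⟨B, D, hB, hD, rfl⟩
      exact hrect B D hB hD
    · intro t ht h
      have h1 := integral_add_compl (hm12 _ ht) (integrable_condExp (m := m1) (f := φ) (μ := μ))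
      have h2 := integral_add_compl (hm12 _ ht) hi
      rw [integral_condExp hm1] at h1
      linarith
    · intro A hdisj hA h
      rw [integral_iUnion (fun i => hm12 _ (hA i)) hdisj integrable_condExp.integrableOn,
        integral_iUnion (fun i => hm12 _ (hA i)) hdisj hi.integrableOn]
      exact tsum_congr h
  exact ae_eq_condExp_of_forall_setIntegral_eq hm12 hi
    (fun _ _ _ => integrable_condExp.integrableOn) (fun A hA _ => hall A hA)
    (StronglyMeasurable.aestronglyMeasurable (m := m1 ⊔ m2)
      (stronglyMeasurable_condExp.mono le_sup_left))

/-- A family of almost sure lower bounds `ψ x ≤ μ[φ x | m]` for conditional expectations may be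
evaluated at a bounded `m`-measurable point. -/
theorem setIntegral_comp_le_of_le_condExp [IsFiniteMeasure μ] {F : Type*} [NormedAddCommGroup F]
    [NormedSpace ℝ F] {m : MeasurableSpace S} (hm : m ≤ m0) {φ : F → S → ℝ} {ψ : F → ℝ}
    (hφm : ∀ x, Measurable[m0] (φ x)) (hφc : ∀ s, Continuous fun x => φ x s) (hψc : Continuous ψ)
    {R M : ℝ} (hφb : ∀ x s, ‖x‖ ≤ R → |φ x s| ≤ M) (hψb : ∀ x, ‖x‖ ≤ R → |ψ x| ≤ M)
    (h : ∀ x, ∀ᵐ s ∂μ, ψ x ≤ (μ[φ x | m]) s) {v : S → F} (hv : StronglyMeasurable[m] v)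
    (hvR : ∀ s, ‖v s‖ ≤ R) {A : Set S} (hA : MeasurableSet[m] A) :
    ∫ s in A, ψ (v s) ∂μ ≤ ∫ s in A, φ (v s) s ∂μ := by
  classical
  -- The exceptional null set depends on `x`, so a random point cannot be inserted directly. A
  -- simple function takes finitely many values, each handled on its own level set; dominated
  -- convergence gives the limit.
  set u := hv.approxBounded R
  have hulim : ∀ s, Tendsto (fun n => u n s) atTop (𝓝 (v s)) := fun s =>
    hv.tendsto_approxBounded_of_norm_le (hvR s)
  have huR : ∀ n s, ‖u n s‖ ≤ R := fun n s =>
    hv.norm_approxBounded_le ((norm_nonneg _).trans (hvR s)) n s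
  have hset : ∀ n x, MeasurableSet[m] (u n ⁻¹' {x}) := fun n x => (u n).measurableSet_preimage _
  have hexp : ∀ n (ξ : F → S → ℝ), (fun s => ξ (u n s) s)
      = fun s => ∑ x ∈ (u n).range, (u n ⁻¹' {x}).indicator (ξ x) s := by
    intro n ξ
    funext s
    refine Eq.trans ?_ (Finset.sum_eq_single
      (f := fun x => (u n ⁻¹' {x}).indicator (ξ x) s) (u n s) (fun x _ hx => ?_) fun hs => ?_).symm
    · simp
    · have hs : s ∉ u n ⁻¹' {x} := fun hs => hx (Set.mem_singleton_iff.1 hs).symm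
      simp only [Set.indicator_of_notMem hs]
    · exact absurd (SimpleFunc.mem_range_self (u n) s) hs
  have hφi : ∀ n, ∀ x ∈ (u n).range, Integrable (φ x) μ := fun n x hx => by
    obtain ⟨s, rfl⟩ := (@SimpleFunc.mem_range _ _ m _ _).1 hx
    exact Integrable.of_bound (hφm _).aestronglyMeasurable M
      (ae_of_all _ fun t => hφb _ t (huR n s))
  have hmeasφ : ∀ n, AEStronglyMeasurable[m0] (fun s => φ (u n s) s) μ := fun n => by
    rw [hexp n φ]
    exact (Finset.measurable_fun_sum _ fun x _ =>
      (hφm x).indicator (hm _ (hset n x))).aestronglyMeasurable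
  have hmeasψ : ∀ n, AEStronglyMeasurable[m0] (fun s => ψ (u n s)) μ := fun n => by
    rw [hexp n fun x _ => ψ x]
    exact (Finset.measurable_fun_sum _ fun x _ =>
      measurable_const.indicator (hm _ (hset n x))).aestronglyMeasurable
  have hn : ∀ n, ∫ s in A, ψ (u n s) ∂μ ≤ ∫ s in A, φ (u n s) s ∂μ := by
    intro n
    rw [hexp n φ, hexp n fun x _ => ψ x, integral_finsetSum, integral_finsetSum]
    · refine Finset.sum_le_sum fun x hx => ?_
      rw [setIntegral_indicator (hm _ (hset n x)), setIntegral_indicator (hm _ (hset n x)),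
        ← setIntegral_condExp hm (hφi n x hx) (hA.inter (hset n x))]
      exact setIntegral_mono_ae (integrable_const _).integrableOn
        integrable_condExp.integrableOn (h x)
    · exact fun x hx => ((hφi n x hx).indicator (hm _ (hset n x))).integrableOn
    · exact fun x hx => ((integrable_const _).indicator (hm _ (hset n x))).integrableOn
  refine le_of_tendsto_of_tendsto' (tendsto_integral_of_dominated_convergence (fun _ => M)
    (fun n => (hmeasψ n).restrict) (integrable_const _)
    (fun n => ae_of_all _ fun s => hψb _ (huR n s))
    (ae_of_all _ fun s => (hψc.tendsto _).comp (hulim s)))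
    (tendsto_integral_of_dominated_convergence (fun _ => M)
    (fun n => (hmeasφ n).restrict) (integrable_const _)
    (fun n => ae_of_all _ fun s => hφb _ s (huR n s))
    (ae_of_all _ fun s => ((hφc s).tendsto _).comp (hulim s))) hn

/-- The hypotheses make the joint law a triple product, which may be bracketed either way. -/
theorem indepFun_prodMk_of_indepFun_prodMk [IsProbabilityMeasure μ] {α β γ : Type*}
    [MeasurableSpace α] [MeasurableSpace β] [MeasurableSpace γ] {X : S → α} {Y : S → β}
    {Z : S → γ} (hX : Measurable X) (hY : Measurable Y) (hZ : Measurable Z)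
    (hXY : IndepFun X Y μ) (h : IndepFun (fun s => (X s, Y s)) Z μ) :
    IndepFun X (fun s => (Y s, Z s)) μ := by
  have := Measure.isProbabilityMeasure_map (μ := μ) hX.aemeasurable
  have := Measure.isProbabilityMeasure_map (μ := μ) hY.aemeasurable
  have := Measure.isProbabilityMeasure_map (μ := μ) hZ.aemeasurable
  have hYZ : IndepFun Y Z μ := h.comp measurable_snd measurable_id
  rw [indepFun_iff_map_prod_eq_prod_map_map hX.aemeasurable (hY.prodMk hZ).aemeasurable,
    hYZ.map_prod_eq_prod_map_map hY.aemeasurable hZ.aemeasurable, ← Measure.prodAssoc_prod,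
    ← hXY.map_prod_eq_prod_map_map hX.aemeasurable hY.aemeasurable,
    ← h.map_prod_eq_prod_map_map (hX.prodMk hY).aemeasurable hZ.aemeasurable,
    Measure.map_map MeasurableEquiv.prodAssoc.measurable ((hX.prodMk hY).prodMk hZ)]
  rfl

end Conditioning

/-! ### Random update counts and inverse stepsizes -/

section Counting

variable {S : Type*} {m0 : MeasurableSpace S} {μ : Measure S}

theorem ae_summable_of_integral_le {Z : ℕ → S → ℝ} (hZi : ∀ k, Integrable (Z k) μ)
    (hZ0 : ∀ k s, 0 ≤ Z k s) {b : ℕ → ℝ} (hb : Summable b) (hZb : ∀ k, ∫ s, Z k s ∂μ ≤ b k) :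
    ∀ᵐ s ∂μ, Summable fun k => Z k s := by
  have hfin : ∫⁻ s, ∑' k, ENNReal.ofReal (Z k s) ∂μ ≠ ⊤ := by
    rw [lintegral_tsum fun k => (hZi k).aestronglyMeasurable.aemeasurable.ennreal_ofReal]
    have : ∀ k, ∫⁻ s, ENNReal.ofReal (Z k s) ∂μ ≤ ENNReal.ofReal (b k) := fun k => by
      rw [← ofReal_integral_eq_lintegral_ofReal (hZi k) (ae_of_all _ (hZ0 k))]
      exact ENNReal.ofReal_le_ofReal (hZb k)
    exact ne_top_of_le_ne_top hb.tsum_ofReal_ne_top (ENNReal.tsum_le_tsum this)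
  filter_upwards [ae_lt_top' (AEMeasurable.tsum fun k =>
    (hZi k).aestronglyMeasurable.aemeasurable.ennreal_ofReal) hfin] with s hs
  refine (ENNReal.summable_toReal hs.ne).congr fun k => ?_
  exact ENNReal.toReal_ofReal (hZ0 k s)

theorem summable_inv_sqrt_cube : Summable fun k : ℕ => 1 / √((k : ℝ) + 1) ^ 3 := by
  have h : Summable fun k : ℕ => 1 / ((k : ℝ)) ^ (3 / 2 : ℝ) :=
    Real.summable_one_div_nat_rpow.2 (by norm_num)
  refine ((summable_nat_add_iff 1).2 h).congr fun k => ?_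
  have : (0 : ℝ) ≤ (k : ℝ) + 1 := by positivity
  rw [Real.sqrt_eq_rpow, ← Real.rpow_natCast, ← Real.rpow_mul this]
  norm_num

/-- Variances of pairwise independent variables add, and each is at most `1`. -/
theorem integral_sq_sum_sub_le [IsProbabilityMeasure μ] {X : ℕ → S → ℝ} {γ : ℝ}
    (hXm : ∀ k, Measurable (X k)) (hX0 : ∀ k s, 0 ≤ X k s) (hX1 : ∀ k s, X k s ≤ 1)
    (hind : Pairwise fun i j => IndepFun (X i) (X j) μ) (hγ : ∀ k, ∫ s, X k s ∂μ = γ) (k : ℕ) :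
    ∫ s, (∑ t ∈ Finset.range k, X t s - k * γ) ^ 2 ∂μ ≤ k := by
  have hb : ∀ k s, ‖X k s‖ ≤ 1 := fun k s => by
    rw [Real.norm_of_nonneg (hX0 k s)]
    exact hX1 k s
  have hL : ∀ k, MemLp (X k) 2 μ := fun k =>
    MemLp.of_bound (hXm k).aestronglyMeasurable 1 (ae_of_all _ (hb k))
  have hi : ∀ k, Integrable (X k) μ := fun k => (hL k).integrable one_le_two
  have hv : Var[∑ t ∈ Finset.range k, X t; μ] ≤ k := by
    rw [IndepFun.variance_sum (fun t _ => hL t) fun i _ j _ hij => hind hij]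
    calc ∑ t ∈ Finset.range k, Var[X t; μ] ≤ ∑ t ∈ Finset.range k, (1 : ℝ) := by
          refine Finset.sum_le_sum fun t _ => ?_
          refine (variance_le_expectation_sq (hXm t).aestronglyMeasurable).trans ?_
          calc _ ≤ ∫ _, (1 : ℝ) ∂μ := by
                refine integral_mono (hL t).integrable_sq (integrable_const _) fun s => ?_
                exact pow_le_one₀ (hX0 t s) (hX1 t s)
            _ = 1 := by simp
      _ = k := by simp
  rw [variance_eq_integral (Finset.aemeasurable_sum _ fun t _ => (hXm t).aemeasurable)] at hv
  have e : ∫ s, (∑ t ∈ Finset.range k, X t) s ∂μ = k * γ := by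
    simp only [Finset.sum_apply]
    rw [integral_finsetSum _ fun t _ => hi t]
    simp [hγ]
  rw [e] at hv
  simpa only [Finset.sum_apply] using hv

/-- Inverse counting stepsizes are summably close to deterministic harmonic stepsizes. -/
theorem ae_summable_inv_count [IsProbabilityMeasure μ] {X : ℕ → S → ℝ} {γ : ℝ} (hγ0 : 0 < γ)
    (hXm : ∀ k, Measurable (X k)) (hX0 : ∀ k s, 0 ≤ X k s) (hX1 : ∀ k s, X k s ≤ 1)
    (hind : Pairwise fun i j => IndepFun (X i) (X j) μ)
    (hident : ∀ k, IdentDistrib (X k) (X 0) μ μ) (hγ : ∀ k, ∫ s, X k s ∂μ = γ) :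
    ∀ᵐ s ∂μ, (Summable fun k : ℕ =>
        |γ * (1 / (∑ t ∈ Finset.range k, X t s + 1)) - 1 / ((k : ℝ) + 1)|) ∧
      Summable fun k : ℕ => (1 / (∑ t ∈ Finset.range k, X t s + 1)) ^ 2 := by
  have hb : ∀ k s, ‖X k s‖ ≤ 1 := fun k s => by
    rw [Real.norm_of_nonneg (hX0 k s)]
    exact hX1 k s
  have hi : ∀ k, Integrable (X k) μ := fun k =>
    Integrable.of_bound (hXm k).aestronglyMeasurable 1 (ae_of_all _ (hb k))
  have hγ1 : γ ≤ 1 := by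
    rw [← hγ 0]
    calc _ ≤ ∫ _, (1 : ℝ) ∂μ := integral_mono (hi 0) (integrable_const _) (hX1 0)
      _ = 1 := by simp
  have hlln := strong_law_ae_real X (hi 0) hind hident
  rw [hγ 0] at hlln
  -- The expected squared deviation is at most `k`, so dividing by `(k + 1) ^ (5 / 2)` leaves the
  -- summable order `(k + 1) ^ (-3 / 2)`.
  have hdev : ∀ᵐ s ∂μ, Summable fun k : ℕ =>
      (∑ t ∈ Finset.range k, X t s - k * γ) ^ 2 / √((k : ℝ) + 1) ^ 5 := by
    refine ae_summable_of_integral_le (fun k => ?_) (fun k s => by positivity)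
      summable_inv_sqrt_cube fun k => ?_
    · refine Integrable.div_const (MemLp.integrable_sq (MemLp.of_bound
        ((Finset.measurable_fun_sum _ fun t _ => hXm t).sub_const _).aestronglyMeasurable
        (k + |k * γ|) (ae_of_all _ fun s => ?_))) _
      refine (norm_sub_le _ _).trans (add_le_add ?_ le_rfl)
      exact (norm_sum_le_of_le _ fun t _ => hb t s).trans (by simp)
    · rw [integral_div]
      have hq : 0 < √((k : ℝ) + 1) := Real.sqrt_pos.2 (by positivity)
      have hq2 : √((k : ℝ) + 1) ^ 2 = (k : ℝ) + 1 := Real.sq_sqrt (by positivity)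
      have := integral_sq_sum_sub_le hXm hX0 hX1 hind hγ k
      rw [div_le_div_iff₀ (by positivity) (by positivity), one_mul]
      calc _ ≤ ((k : ℝ) + 1) * √((k : ℝ) + 1) ^ 3 := by gcongr; linarith
        _ = _ := by
          generalize √((k : ℝ) + 1) = q at hq2
          rw [← hq2]
          ring
  have hsq : Summable fun k : ℕ => 1 / ((k : ℝ) + 1) ^ 2 := by
    refine ((summable_nat_add_iff 1).2 (Real.summable_one_div_nat_pow.2 one_lt_two)).congr
      fun k => ?_
    push_cast
    rfl
  filter_upwards [hlln, hdev] with s hs hd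
  -- The strong law makes the count at least half its mean eventually; `γ ≤ 1` covers the two `+ 1`.
  have hev : ∀ᶠ k : ℕ in atTop,
      γ / 2 * ((k : ℝ) + 1) ≤ ∑ t ∈ Finset.range k, X t s + 1 := by
    filter_upwards [hs.eventually (lt_mem_nhds (half_lt_self hγ0)), eventually_gt_atTop 0]
      with k hk hk0
    have : (0 : ℝ) < k := Nat.cast_pos.2 hk0
    rw [lt_div_iff₀ this] at hk
    linarith
  constructor
  · refine Summable.of_norm_bounded_eventually_nat
      (((hd.add summable_inv_sqrt_cube).mul_left (1 / γ)).add (hsq.mul_left (2 / γ))) ?_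
    filter_upwards [hev] with k hk
    set N := ∑ t ∈ Finset.range k, X t s
    have hq : 0 < √((k : ℝ) + 1) := Real.sqrt_pos.2 (by positivity)
    have hq2 : (k : ℝ) + 1 = √((k : ℝ) + 1) ^ 2 := (Real.sq_sqrt (by positivity)).symm
    have hk1 : (0 : ℝ) < (k : ℝ) + 1 := by positivity
    have hN : 0 < N + 1 := lt_of_lt_of_le (by positivity) hk
    rw [Real.norm_eq_abs, abs_abs]
    have e : γ * (1 / (N + 1)) - 1 / ((k : ℝ) + 1)
        = (γ * ((k : ℝ) + 1) - (N + 1)) / ((N + 1) * ((k : ℝ) + 1)) := by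
      field_simp
    rw [e, abs_div, abs_of_pos (mul_pos hN hk1)]
    have h1 : |γ * ((k : ℝ) + 1) - (N + 1)| ≤ |N - k * γ| + 1 := by
      rw [show γ * ((k : ℝ) + 1) - (N + 1) = -(N - k * γ) + (γ - 1) by ring]
      refine (abs_add_le _ _).trans ?_
      rw [abs_neg]
      have : |γ - 1| ≤ 1 := abs_le.2 ⟨by linarith, by linarith⟩
      linarith
    -- With `q = √(k + 1)`, this is `(Y / q - 1) ^ 2 / q ^ 3 ≥ 0`; it trades the absolute deviation
    -- for its summable square.
    have h2 : 2 * (|N - k * γ| / ((k : ℝ) + 1) ^ 2)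
        ≤ (N - k * γ) ^ 2 / √((k : ℝ) + 1) ^ 5 + 1 / √((k : ℝ) + 1) ^ 3 := by
      rw [← sq_abs (N - k * γ)]
      generalize |N - k * γ| = Y
      generalize √((k : ℝ) + 1) = q at hq hq2
      rw [hq2]
      have : 0 ≤ (Y / q - 1) ^ 2 / q ^ 3 := by positivity
      have e : (Y / q - 1) ^ 2 / q ^ 3 = Y ^ 2 / q ^ 5 + 1 / q ^ 3 - 2 * (Y / (q ^ 2) ^ 2) := by
        field_simp
        ring
      linarith
    calc |γ * ((k : ℝ) + 1) - (N + 1)| / ((N + 1) * ((k : ℝ) + 1))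
        ≤ (|N - k * γ| + 1) / (γ / 2 * ((k : ℝ) + 1) * ((k : ℝ) + 1)) := by gcongr
      _ = 1 / γ * (2 * (|N - k * γ| / ((k : ℝ) + 1) ^ 2)) + 2 / γ * (1 / ((k : ℝ) + 1) ^ 2) := by
          field_simp
      _ ≤ _ := by gcongr
  · refine Summable.of_norm_bounded_eventually_nat (hsq.mul_left ((2 / γ) ^ 2)) ?_
    filter_upwards [hev] with k hk
    have hk1 : (0 : ℝ) < (k : ℝ) + 1 := by positivity
    rw [Real.norm_of_nonneg (by positivity)]
    calc (1 / (∑ t ∈ Finset.range k, X t s + 1)) ^ 2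
        ≤ (1 / (γ / 2 * ((k : ℝ) + 1))) ^ 2 := by
          have : 0 ≤ 1 / (∑ t ∈ Finset.range k, X t s + 1) :=
            one_div_nonneg.2 (lt_of_lt_of_le (by positivity) hk).le
          gcongr
      _ = _ := by field_simp

theorem integral_comp_eq_sum [IsFiniteMeasure μ] {α : Type*} [Fintype α] [MeasurableSpace α]
    [MeasurableSingletonClass α] {g : S → α} (hg : Measurable g) (h : α → ℝ) :
    ∫ s, h (g s) ∂μ = ∑ e, μ.real (g ⁻¹' {e}) * h e := by
  rw [← integral_map (φ := g) hg.aemeasurable (measurable_of_finite h).aestronglyMeasurable,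
    integral_fintype]
  · simp only [smul_eq_mul, measureReal_def, Measure.map_apply hg (measurableSet_singleton _)]
  · exact Integrable.of_finite

theorem identDistrib_of_measureReal_preimage_singleton [IsFiniteMeasure μ] {α : Type*} [Fintype α]
    [MeasurableSpace α] [MeasurableSingletonClass α] {g g' : S → α} (hg : Measurable g)
    (hg' : Measurable g') (h : ∀ e, μ.real (g ⁻¹' {e}) = μ.real (g' ⁻¹' {e})) :
    IdentDistrib g g' μ μ := by
  refine ⟨hg.aemeasurable, hg'.aemeasurable, Measure.ext_of_singleton fun e => ?_⟩
  rw [Measure.map_apply hg (measurableSet_singleton _),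
    Measure.map_apply hg' (measurableSet_singleton _)]
  have := h e
  rwa [measureReal_def, measureReal_def,
    ENNReal.toReal_eq_toReal_iff' (measure_ne_top _ _) (measure_ne_top _ _)] at this

theorem ae_summable_inv_updateCount [IsProbabilityMeasure μ] {m : ℕ}
    {g : ℕ → S → Fin m × Fin m} (hg : ∀ k, Measurable (g k)) {q : Fin m → Fin m → ℝ}
    (hq0 : ∀ i, q i i = 0)
    (hlaw : ∀ k e, μ.real (g k ⁻¹' {e}) = q e.1 e.2) (hind : iIndepFun g μ) (i : Fin m)
    (hpos : 0 < ∑ j, (q i j + q j i)) :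
    ∀ᵐ s ∂μ, (Summable fun k : ℕ => |(∑ j, (q i j + q j i)) *
        (1 / ((updateCount (fun t => g t s) i k : ℝ) + 1)) - 1 / ((k : ℝ) + 1)|) ∧
      Summable fun k : ℕ => (1 / ((updateCount (fun t => g t s) i k : ℝ) + 1)) ^ 2 := by
  set h : Fin m × Fin m → ℝ := fun e => if i = e.1 ∨ i = e.2 then 1 else 0 with hh
  have hhm : Measurable h := measurable_of_finite h
  have hcount : ∀ s k, (updateCount (fun t => g t s) i k : ℝ)
      = ∑ t ∈ Finset.range k, h (g t s) := fun s k => by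
    simp [updateCount, hh, Finset.sum_boole]
  have hmean : ∀ k, ∫ s, h (g k s) ∂μ = ∑ j, (q i j + q j i) := fun k => by
    rw [integral_comp_eq_sum (hg k) h, Fintype.sum_prod_type]
    simp only [hlaw]
    -- The indicator of a union splits into a sum except at `a = b = i`, where `q` vanishes.
    have : ∀ a b, q a b * h (a, b)
        = q a b * ((if a = i then 1 else 0) + (if b = i then 1 else 0)) := fun a b => by
      simp only [hh]
      by_cases h1 : a = i <;> by_cases h2 : b = i
      · subst h1; subst h2; simp [hq0]
      · subst h1; simp [h2]
      · subst h2; simp [h1]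
      · simp [h1, h2, Ne.symm h1, Ne.symm h2]
    simp only [this]
    rw [sum_sum_mul_add q fun l => if l = i then (1 : ℝ) else 0]
    simp
  have := ae_summable_inv_count (X := fun k s => h (g k s)) hpos (fun k => hhm.comp (hg k))
    (fun k s => by simp only [hh]; split_ifs <;> norm_num)
    (fun k s => by simp only [hh]; split_ifs <;> norm_num)
    (fun a b hab => (hind.indepFun hab).comp hhm hhm)
    (fun k => (identDistrib_of_measureReal_preimage_singleton (hg k) (hg 0)
      fun e => by rw [hlaw, hlaw]).comp hhm) hmean
  simpa only [hcount] using this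

end Counting

/-! ### Growth and decrease terms of the drift inequality -/

section Drift

variable {m d : ℕ} {ι : Fin m → Type*}

/-- The relative growth of the expected squared distance in one step, with stepsizes `a`. -/
noncomputable def growth (q : Fin m → Fin m → ℝ) (K B b : ℝ) (a : Fin m → ℝ) : ℝ :=
  K * ∑ l, (∑ j, (q l j + q j l)) * a l ^ 2
    + 2 * B * ∑ l, |(∑ j, (q l j + q j l)) * a l - b|

/-- The expected decrease of the squared distance to the feasible point `y` in one step. -/
noncomputable def decrease (f : Fin m → EuclideanSpace ℝ (Fin d) → ℝ)
    (X : Set (EuclideanSpace ℝ (Fin d))) (q : Fin m → Fin m → ℝ) (c b : ℝ) (r : Fin m)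
    (y : EuclideanSpace ℝ (Fin d)) (x : Fin m → EuclideanSpace ℝ (Fin d)) : ℝ :=
  1 / 4 * ∑ i, ∑ j, q i j * ‖x i - x j‖ ^ 2
    + 1 / c * ∑ i, ∑ j, q i j * Metric.infDist (midpoint ℝ (x i) (x j)) X ^ 2
    + 2 * b * (objective f (proj X (x r)) - objective f y)

theorem continuous_growth (q : Fin m → Fin m → ℝ) (K B b : ℝ) : Continuous (growth q K B b) := by
  unfold growth
  fun_prop

theorem growth_nonneg {q : Fin m → Fin m → ℝ} (hq : ∀ i j, 0 ≤ q i j) {K B : ℝ} (hK : 0 ≤ K)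
    (hB : 0 ≤ B) (b : ℝ) (a : Fin m → ℝ) : 0 ≤ growth q K B b a :=
  add_nonneg (mul_nonneg hK (Finset.sum_nonneg fun _ _ =>
    mul_nonneg (Finset.sum_nonneg fun _ _ => add_nonneg (hq _ _) (hq _ _)) (sq_nonneg _)))
    (mul_nonneg (mul_nonneg zero_le_two hB) (Finset.sum_nonneg fun _ _ => abs_nonneg _))

theorem continuous_proj {X : Set (EuclideanSpace ℝ (Fin d))} (hX : IsClosed X)
    (hXc : Convex ℝ X) (hne : X.Nonempty) : Continuous (proj X) :=
  (LipschitzWith.of_dist_le_mul (K := 1) fun x y => by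
    simpa [dist_eq_norm] using norm_proj_sub_proj_le hX hXc hne x y).continuous

theorem continuous_objective {f : Fin m → EuclideanSpace ℝ (Fin d) → ℝ}
    (hf : ∀ i, Continuous (f i)) : Continuous (objective f) := by
  unfold objective
  fun_prop

theorem continuous_infDist_midpoint (X : Set (EuclideanSpace ℝ (Fin d))) (i j : Fin m) :
    Continuous fun x : Fin m → EuclideanSpace ℝ (Fin d) =>
      Metric.infDist (midpoint ℝ (x i) (x j)) X := by
  refine (Metric.continuous_infDist_pt X).comp ?_
  simp only [midpoint_eq_smul_add]
  fun_prop

theorem continuous_decrease {f : Fin m → EuclideanSpace ℝ (Fin d) → ℝ}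
    (hf : ∀ i, Continuous (f i)) {X : Set (EuclideanSpace ℝ (Fin d))} (hX : IsClosed X)
    (hXc : Convex ℝ X) (hne : X.Nonempty) (q : Fin m → Fin m → ℝ) (c b : ℝ) (r : Fin m)
    (y : EuclideanSpace ℝ (Fin d)) : Continuous (decrease f X q c b r y) := by
  have h1 := continuous_infDist_midpoint (m := m) X
  have h2 := continuous_proj hX hXc hne
  have h3 := continuous_objective hf
  unfold decrease
  fun_prop

/-- The objective gap is taken at a projected point because an infeasible estimate may have a
smaller value than the minimizer `y`. -/
theorem decrease_nonneg {f : Fin m → EuclideanSpace ℝ (Fin d) → ℝ}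
    {X : Set (EuclideanSpace ℝ (Fin d))} (hX : IsClosed X)
    {q : Fin m → Fin m → ℝ} (hq : ∀ i j, 0 ≤ q i j) {c b : ℝ} (hc : 0 < c) (hb : 0 ≤ b)
    (r : Fin m) {y : EuclideanSpace ℝ (Fin d)} (hy : y ∈ X)
    (hmin : ∀ z ∈ X, objective f y ≤ objective f z)
    (x : Fin m → EuclideanSpace ℝ (Fin d)) : 0 ≤ decrease f X q c b r y x := by
  have h1 : 0 ≤ ∑ i, ∑ j, q i j * ‖x i - x j‖ ^ 2 :=
    Finset.sum_nonneg fun i _ => Finset.sum_nonneg fun j _ => mul_nonneg (hq i j) (sq_nonneg _)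
  have h2 : 0 ≤ ∑ i, ∑ j, q i j * Metric.infDist (midpoint ℝ (x i) (x j)) X ^ 2 :=
    Finset.sum_nonneg fun i _ => Finset.sum_nonneg fun j _ => mul_nonneg (hq i j) (sq_nonneg _)
  have h3 := sub_nonneg.2 (hmin _ (proj_mem hX ⟨y, hy⟩ (x r)))
  unfold decrease
  positivity

end Drift

/-! ### The conditional drift of one step -/

section Step

variable {m d : ℕ} {ι : Fin m → Type*} {S : Type*}

theorem integrable_comp_of_bounded {m0 : MeasurableSpace S} {μ : Measure S} [IsFiniteMeasure μ]
    {Y : Type*} [NormedAddCommGroup Y] [ProperSpace Y] [MeasurableSpace Y] [BorelSpace Y]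
    {Z : S → Y} (hZ : Measurable Z) {R : ℝ} (hR : ∀ s, ‖Z s‖ ≤ R) {ψ : Y → ℝ}
    (hψ : Continuous ψ) : Integrable (fun s => ψ (Z s)) μ := by
  obtain ⟨M, hM⟩ := (isCompact_closedBall (0 : Y) R).exists_bound_of_continuousOn hψ.continuousOn
  exact Integrable.of_bound (hψ.measurable.comp hZ).aestronglyMeasurable M
    (ae_of_all _ fun s => hM _ (by simpa using hR s))

theorem measurable_edgeStep [MeasurableSpace S] [∀ i, MeasurableSpace (ι i)]
    {f : Fin m → EuclideanSpace ℝ (Fin d) → ℝ}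
    {C : ∀ i, ι i → Set (EuclideanSpace ℝ (Fin d))}
    (hCc : ∀ i j, IsClosed (C i j)) (hCv : ∀ i j, Convex ℝ (C i j))
    (hCm : ∀ i x, Measurable fun j => Metric.infDist x (C i j))
    (hne : ∀ i j, (C i j).Nonempty) (hgrad : ∀ i, Continuous (gradient (f i)))
    {a : S → Fin m → ℝ} (ha : Measurable a) (i j : Fin m) {w : S → ∀ i, ι i} (hw : Measurable w)
    {x : S → Fin m → EuclideanSpace ℝ (Fin d)} (hx : Measurable x) :
    Measurable fun s => edgeStep f C (a s) i j (w s) (x s) := by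
  refine measurable_pi_lambda _ fun l => ?_
  have hxl : ∀ l, Measurable fun s => x s l := fun l => (measurable_pi_apply l).comp hx
  have hal : Measurable fun s => a s l := (measurable_pi_apply l).comp ha
  have hwl : Measurable fun s => w s l := (measurable_pi_apply l).comp hw
  by_cases h : l = i ∨ l = j
  · simp only [edgeStep, h, if_true, midpoint_eq_smul_add]
    have hv : Measurable fun s => (⅟2 : ℝ) • (x s i + x s j) :=
      ((hxl i).add (hxl j)).const_smul (⅟2 : ℝ)
    have hg : Measurable fun s => gradient (f l) ((⅟2 : ℝ) • (x s i + x s j)) :=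
      (hgrad l).measurable.comp hv
    have := (measurable_proj (hCc l) (hCv l) (hne l) (hCm l)).comp
      (hwl.prodMk (hv.sub (hal.smul hg)))
    exact this
  · simp only [edgeStep, h, if_false]
    exact hxl l

/-- A crude bound that deteriorates from step to step; it serves integrability only. -/
theorem norm_edgeStep_le {f : Fin m → EuclideanSpace ℝ (Fin d) → ℝ}
    {C : ∀ i, ι i → Set (EuclideanSpace ℝ (Fin d))}
    (hCc : ∀ i j, IsClosed (C i j)) (hCv : ∀ i j, Convex ℝ (C i j)) {B L : ℝ} (hL0 : 0 ≤ L)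
    (hB : ∀ i, ∀ x ∈ feasibleSet C, ‖gradient (f i) x‖ ≤ B)
    (hL : ∀ i x y, ‖gradient (f i) x - gradient (f i) y‖ ≤ L * ‖x - y‖)
    {a : Fin m → ℝ} (ha0 : ∀ l, 0 ≤ a l) (ha1 : ∀ l, a l ≤ 1)
    {y : EuclideanSpace ℝ (Fin d)} (hy : y ∈ feasibleSet C) (i j : Fin m) (w : ∀ i, ι i)
    {x : Fin m → EuclideanSpace ℝ (Fin d)} {R : ℝ} (hx : ∀ l, ‖x l‖ ≤ R) (l : Fin m) :
    ‖edgeStep f C a i j w x l‖ ≤ R + 2 * ‖y‖ + B + L * (R + ‖y‖) := by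
  have hB0 : 0 ≤ B := (norm_nonneg _).trans (hB l y hy)
  have hR0 : 0 ≤ R := (norm_nonneg _).trans (hx l)
  by_cases h : l = i ∨ l = j
  · simp only [edgeStep, h, if_true]
    set v := midpoint ℝ (x i) (x j) with hv
    set p := proj (C l (w l)) (v - a l • gradient (f l) v)
    have h1 : ‖v‖ ≤ R := by
      rw [hv, midpoint_eq_smul_add, norm_smul]
      have := norm_add_le (x i) (x j)
      norm_num
      linarith [hx i, hx j]
    have h2 : ‖v - y‖ ≤ R + ‖y‖ := (norm_sub_le _ _).trans (by linarith)
    have h3 : ‖gradient (f l) v‖ ≤ B + L * (R + ‖y‖) := by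
      have h4 := norm_add_le (gradient (f l) v - gradient (f l) y) (gradient (f l) y)
      rw [sub_add_cancel] at h4
      linarith [hL l v y, hB l y hy, mul_le_mul_of_nonneg_left h2 hL0]
    have h4 : ‖p - y‖ ≤ ‖v - a l • gradient (f l) v - y‖ := by
      have := norm_proj_sub_sq_le (hCc l (w l)) (hCv l (w l)) (v - a l • gradient (f l) v)
        (feasibleSet_subset l (w l) hy)
      exact (pow_le_pow_iff_left₀ (norm_nonneg _) (norm_nonneg _) two_ne_zero).1
        (this.trans (sub_le_self _ (sq_nonneg _)))
    have h5 : ‖v - a l • gradient (f l) v - y‖ ≤ ‖v - y‖ + ‖gradient (f l) v‖ := by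
      rw [sub_right_comm]
      refine (norm_sub_le _ _).trans (add_le_add le_rfl ?_)
      rw [norm_smul, Real.norm_of_nonneg (ha0 l)]
      exact mul_le_of_le_one_left (norm_nonneg _) (ha1 l)
    have h6 := norm_add_le (p - y) y
    rw [sub_add_cancel] at h6
    linarith
  · simp only [edgeStep, h, if_false]
    have := norm_nonneg y
    have : 0 ≤ L * (R + ‖y‖) := by positivity
    linarith [hx l]

/-- The one-step drift inequality, integrated over events that are known before the step. -/
theorem setIntegral_edgeStep_le {m0 : MeasurableSpace S} {μ : Measure S} [IsProbabilityMeasure μ]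
    [∀ i, MeasurableSpace (ι i)] {f : Fin m → EuclideanSpace ℝ (Fin d) → ℝ}
    {C : ∀ i, ι i → Set (EuclideanSpace ℝ (Fin d))}
    (hCc : ∀ i j, IsClosed (C i j)) (hCv : ∀ i j, Convex ℝ (C i j))
    (hCm : ∀ i x, Measurable fun j => Metric.infDist x (C i j))
    (hf : ∀ i, ConvexOn ℝ Set.univ (f i)) (hfd : ∀ i, Differentiable ℝ (f i))
    {B L c κ : ℝ} (hL0 : 0 ≤ L)
    (hB : ∀ i, ∀ x ∈ feasibleSet C, ‖gradient (f i) x‖ ≤ B)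
    (hL : ∀ i x y, ‖gradient (f i) x - gradient (f i) y‖ ≤ L * ‖x - y‖)
    (hc : 0 < c) (hκ : 0 < κ)
    {q : Fin m → Fin m → ℝ} (hq : ∀ i j, 0 ≤ q i j) (hq0 : ∀ i, q i i = 0)
    (hq1 : ∑ i, ∑ j, q i j = 1) (r : Fin m)
    (hκr : ∀ x : Fin m → EuclideanSpace ℝ (Fin d),
      ∑ l, ‖x l - x r‖ ^ 2 ≤ κ * ∑ i, ∑ j, q i j * ‖x i - x j‖ ^ 2)
    {F : MeasurableSpace S} (hF : F ≤ m0) {g : S → Fin m × Fin m} (hg : Measurable[m0] g)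
    (hlaw : ∀ e, μ.real (g ⁻¹' {e}) = q e.1 e.2)
    {w : S → ∀ i, ι i} (hw : Measurable[m0] w)
    (hind : Indep (F ⊔ MeasurableSpace.comap w inferInstance)
      (MeasurableSpace.comap g inferInstance) μ)
    (hreg : ∀ i x, ∀ᵐ s ∂μ, Metric.infDist x (feasibleSet C) ^ 2
      ≤ c * (μ[fun s' => Metric.infDist x (C i (w s' i)) ^ 2 | F]) s)
    {a : S → Fin m → ℝ} (ha : Measurable[F] a) (ha0 : ∀ s l, 0 ≤ a s l)
    (ha1 : ∀ s l, a s l ≤ 1)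
    {x : S → Fin m → EuclideanSpace ℝ (Fin d)} (hx : Measurable[F] x) {R : ℝ}
    (hxR : ∀ s l, ‖x s l‖ ≤ R) {y : EuclideanSpace ℝ (Fin d)} (hy : y ∈ feasibleSet C) (b : ℝ)
    {A : Set S} (hA : MeasurableSet[F] A) :
    ∫ s in A, (1 + ∑ l, ‖edgeStep f C (a s) (g s).1 (g s).2 (w s) (x s) l - y‖ ^ 2) ∂μ
      ≤ ∫ s in A, ((1 + growth q (4 * c * B ^ 2 + B ^ 2 / (1 / (8 * κ)) + 8 * B ^ 2 + 8 * L ^ 2)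
          B b (a s)) * (1 + ∑ l, ‖x s l - y‖ ^ 2) - decrease f (feasibleSet C) q c b r y (x s))
        ∂μ := by
  set X := feasibleSet C with hXdef
  have hX : IsClosed X := isClosed_feasibleSet hCc
  have hXc : Convex ℝ X := convex_feasibleSet hCv
  have hXne : X.Nonempty := ⟨y, hy⟩
  have hCne : ∀ i j, (C i j).Nonempty := fun i j => hXne.mono (feasibleSet_subset i j)
  have hgrad : ∀ i, Continuous (gradient (f i)) := fun i =>
    (LipschitzWith.of_dist_le_mul (K := ⟨L, hL0⟩) fun x y => by
      rw [dist_eq_norm, dist_eq_norm]; exact hL i x y).continuous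
  have hfc : ∀ i, Continuous (f i) := fun i => (hfd i).continuous
  have hm1 : F ⊔ MeasurableSpace.comap w inferInstance ≤ m0 := sup_le hF hw.comap_le
  set θ := 1 / (8 * κ) with hθ
  have hθ0 : 0 < θ := by positivity
  set K := 4 * c * B ^ 2 + B ^ 2 / θ + 8 * B ^ 2 + 8 * L ^ 2 with hK
  have hA0 : MeasurableSet[m0] A := hF _ hA
  -- the new state if the edge `e` is active
  set W : Fin m × Fin m → S → ℝ := fun e s =>
    1 + ∑ l, ‖edgeStep f C (a s) e.1 e.2 (w s) (x s) l - y‖ ^ 2 with hW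
  have hψ : Continuous fun x : Fin m → EuclideanSpace ℝ (Fin d) => 1 + ∑ l, ‖x l - y‖ ^ 2 := by
    fun_prop
  have hstepm : ∀ e : Fin m × Fin m, Measurable[F ⊔ MeasurableSpace.comap w inferInstance]
      fun s => edgeStep f C (a s) e.1 e.2 (w s) (x s) := fun e =>
    @measurable_edgeStep _ _ _ _ (F ⊔ MeasurableSpace.comap w inferInstance) _ _ _ hCc hCv hCm
      hCne hgrad _ (ha.mono le_sup_left le_rfl) e.1 e.2 _
      ((comap_measurable w).mono le_sup_right le_rfl) _ (hx.mono le_sup_left le_rfl)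
  have hWm : ∀ e, Measurable[F ⊔ MeasurableSpace.comap w inferInstance] (W e) := fun e =>
    hψ.measurable.comp (hstepm e)
  have hR0 : 0 ≤ R := by
    obtain ⟨s⟩ : Nonempty S := nonempty_of_isProbabilityMeasure μ
    exact (norm_nonneg _).trans (hxR s r)
  have hB0 : 0 ≤ B := (norm_nonneg _).trans (hB r y hy)
  have hWi : ∀ e, Integrable (W e) μ := fun e =>
    integrable_comp_of_bounded ((hstepm e).mono hm1 le_rfl)
      (fun s => (pi_norm_le_iff_of_nonneg (by positivity)).2 fun l =>
        norm_edgeStep_le hCc hCv hL0 hB hL (ha0 s) (ha1 s) hy e.1 e.2 (w s) (hxR s) l) hψ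
  -- the state before the step
  have hZm : Measurable[m0] fun s => (a s, x s) :=
    (ha.mono hF le_rfl).prodMk (hx.mono hF le_rfl)
  have hZb : ∀ s, ‖(a s, x s)‖ ≤ max 1 R := fun s => by
    refine max_le_max ((pi_norm_le_iff_of_nonneg zero_le_one).2 fun l => ?_)
      ((pi_norm_le_iff_of_nonneg hR0).2 (hxR s))
    rw [Real.norm_of_nonneg (ha0 s l)]
    exact ha1 s l
  have hZi : ∀ ψ : (Fin m → ℝ) × (Fin m → EuclideanSpace ℝ (Fin d)) → ℝ, Continuous ψ →
      Integrable (fun s => ψ (a s, x s)) μ := fun ψ hψ => integrable_comp_of_bounded hZm hZb hψ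
  have hmid := continuous_infDist_midpoint (m := m) X
  have hproj := continuous_proj hX hXc hXne
  -- the part of the one-step estimate that does not depend on the samples
  set H : Fin m × Fin m → S → ℝ := fun e s => ∑ l, ‖x s l - y‖ ^ 2
      - 1 / 2 * ‖x s e.1 - x s e.2‖ ^ 2
      - 2 * (a s e.1 * (f e.1 (proj X (x s r)) - f e.1 y)
        + a s e.2 * (f e.2 (proj X (x s r)) - f e.2 y))
      + 2 * θ * ∑ l, ‖x s l - x s r‖ ^ 2
      + K * (a s e.1 ^ 2 + a s e.2 ^ 2) * (1 + ∑ l, ‖x s l - y‖ ^ 2) with hH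
  have hHi : ∀ e, Integrable (H e) μ := fun e => hZi (fun Z => ∑ l, ‖Z.2 l - y‖ ^ 2
      - 1 / 2 * ‖Z.2 e.1 - Z.2 e.2‖ ^ 2
      - 2 * (Z.1 e.1 * (f e.1 (proj X (Z.2 r)) - f e.1 y)
        + Z.1 e.2 * (f e.2 (proj X (Z.2 r)) - f e.2 y))
      + 2 * θ * ∑ l, ‖Z.2 l - Z.2 r‖ ^ 2
      + K * (Z.1 e.1 ^ 2 + Z.1 e.2 ^ 2) * (1 + ∑ l, ‖Z.2 l - y‖ ^ 2)) (by fun_prop)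
  set D : Fin m × Fin m → S → ℝ := fun e s =>
    Metric.infDist (midpoint ℝ (x s e.1) (x s e.2)) X ^ 2 with hD
  have hDi : ∀ e, Integrable (D e) μ := fun e =>
    hZi (fun Z => Metric.infDist (midpoint ℝ (Z.2 e.1) (Z.2 e.2)) X ^ 2)
      (((hmid e.1 e.2).comp continuous_snd).pow 2)
  set T : Fin m × Fin m → Fin m → S → ℝ := fun e l s =>
    Metric.infDist (midpoint ℝ (x s e.1) (x s e.2)) (C l (w s l)) ^ 2 with hT
  have hTD : ∀ l x s, Metric.infDist x (C l (w s l)) ≤ Metric.infDist x X := fun l x s =>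
    Metric.infDist_le_infDist_of_subset (feasibleSet_subset l (w s l)) hXne
  have hvm : ∀ e : Fin m × Fin m, Measurable[F] fun s => midpoint ℝ (x s e.1) (x s e.2) :=
    fun e => by
      simp only [midpoint_eq_smul_add]
      exact (((measurable_pi_apply e.1).comp hx).add ((measurable_pi_apply e.2).comp hx)).const_smul
        (⅟2 : ℝ)
  have hwl : ∀ l, Measurable[m0] fun s => w s l := fun l => (measurable_pi_apply l).comp hw
  have hTi : ∀ e l, Integrable (T e l) μ := fun e l => by
    refine (hDi e).mono' ?_ (ae_of_all _ fun s => ?_)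
    · have h1 : Measurable[m0] fun s => (w s l, midpoint ℝ (x s e.1) (x s e.2)) :=
        (hwl l).prodMk ((hvm e).mono hF le_rfl)
      exact (((measurable_infDist_family (hCm l)).comp h1).pow_const 2).aestronglyMeasurable
    · rw [Real.norm_of_nonneg (sq_nonneg _)]
      exact pow_le_pow_left₀ Metric.infDist_nonneg (hTD l _ s) 2
  -- the regularity assumption at the random averaged point
  have hregT : ∀ e l, ∫ s in A, D e s ∂μ ≤ c * ∫ s in A, T e l s ∂μ := by
    intro e l
    obtain ⟨M, hM⟩ := (isCompact_closedBall (0 : EuclideanSpace ℝ (Fin d)) R)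
      |>.exists_bound_of_continuousOn
        (f := fun x => Metric.infDist x X ^ 2)
        ((Metric.continuous_infDist_pt X).pow 2).continuousOn
    have hM' : ∀ x : EuclideanSpace ℝ (Fin d), ‖x‖ ≤ R → Metric.infDist x X ^ 2 ≤ M :=
      fun x hx => (le_abs_self _).trans (hM x (by simpa using hx))
    have hvR : ∀ s, ‖midpoint ℝ (x s e.1) (x s e.2)‖ ≤ R := fun s => by
      rw [midpoint_eq_smul_add, norm_smul]
      have := norm_add_le (x s e.1) (x s e.2)
      norm_num
      linarith [hxR s e.1, hxR s e.2]
    have hcM : ∀ x : EuclideanSpace ℝ (Fin d), ‖x‖ ≤ R →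
        |1 / c * Metric.infDist x X ^ 2| ≤ max (1 / c * M) M := fun x hx => by
      rw [abs_of_nonneg (by positivity)]
      exact le_max_of_le_left (mul_le_mul_of_nonneg_left (hM' x hx) (by positivity))
    have := setIntegral_comp_le_of_le_condExp (μ := μ) hF
      (φ := fun x s => Metric.infDist x (C l (w s l)) ^ 2)
      (ψ := fun x => 1 / c * Metric.infDist x X ^ 2) (R := R) (M := max (1 / c * M) M)
      (fun x => ((hCm l x).comp (hwl l)).pow_const 2)
      (fun s => (Metric.continuous_infDist_pt _).pow 2)
      (((Metric.continuous_infDist_pt _).pow 2).const_mul _)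
      (fun x s hx => by
        rw [abs_of_nonneg (sq_nonneg _)]
        exact le_max_of_le_right
          ((pow_le_pow_left₀ Metric.infDist_nonneg (hTD l x s) 2).trans (hM' x hx)))
      hcM
      (fun x => (hreg l x).mono fun s hs => by
        rw [one_div, inv_mul_le_iff₀ hc]
        exact hs)
      (hvm e).stronglyMeasurable hvR hA
    rw [integral_const_mul, one_div, inv_mul_le_iff₀ hc] at this
    exact this
  have hedge : ∀ e : Fin m × Fin m, q e.1 e.2 * ∫ s in A, W e s ∂μ
      ≤ ∫ s in A, q e.1 e.2 * (1 + (H e s - 1 / c * D e s)) ∂μ := by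
    intro e
    rw [integral_const_mul]
    -- The one-step estimate needs two distinct ends; loops have probability zero.
    rcases eq_or_ne e.1 e.2 with h | h
    · rw [h, hq0]
      simp
    refine mul_le_mul_of_nonneg_left ?_ (hq _ _)
    have h1 : ∀ s, W e s ≤ 1 + H e s + 1 / (2 * c) * D e s
        - 3 / 4 * (T e e.1 s + T e e.2 s) := fun s => by
      have := sum_norm_edgeStep_sub_sq_le hCc hCv hf hfd hB hL hc hθ0 (ha0 s) hy h r (w s) (x s)
      rw [← hXdef, ← hK] at this
      simp only [hW, hH, hD, hT]
      rw [one_div_mul_eq_div (2 * c)]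
      linarith
    have hi0 : Integrable (fun s => 1 + H e s) μ := (integrable_const 1).add (hHi e)
    have hiD : ∀ t : ℝ, Integrable (fun s => t * D e s) μ := fun t => (hDi e).const_mul t
    have hi1 : Integrable (fun s => 1 + H e s + 1 / (2 * c) * D e s) μ := hi0.add (hiD _)
    have hi2 : Integrable (fun s => 3 / 4 * (T e e.1 s + T e e.2 s)) μ :=
      ((hTi e e.1).add (hTi e e.2)).const_mul _
    calc ∫ s in A, W e s ∂μ
        ≤ ∫ s in A, (1 + H e s + 1 / (2 * c) * D e s - 3 / 4 * (T e e.1 s + T e e.2 s)) ∂μ :=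
          setIntegral_mono (hWi e).integrableOn (hi1.sub hi2).integrableOn h1
      _ = ∫ s in A, (1 + H e s) ∂μ + 1 / (2 * c) * ∫ s in A, D e s ∂μ
          - 3 / 4 * (∫ s in A, T e e.1 s ∂μ + ∫ s in A, T e e.2 s ∂μ) := by
          rw [integral_sub hi1.integrableOn hi2.integrableOn,
            integral_add hi0.integrableOn (hiD _).integrableOn, integral_const_mul,
            integral_const_mul,
            integral_add (hTi e e.1).integrableOn (hTi e e.2).integrableOn]
      -- Regularity at both ends gives the net coefficient `1 / (2 * c) - 2 * (3 / 4) / c = -1 / c`.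
      _ ≤ ∫ s in A, (1 + H e s) ∂μ - 1 / c * ∫ s in A, D e s ∂μ := by
          have h2 := (inv_mul_le_iff₀ hc).2 (hregT e e.1)
          have h3 := (inv_mul_le_iff₀ hc).2 (hregT e e.2)
          have e1 : 1 / (2 * c) * ∫ s in A, D e s ∂μ = 1 / 2 * (c⁻¹ * ∫ s in A, D e s ∂μ) := by
            field_simp
          rw [e1, one_div c]
          linarith
      _ = _ := by
          rw [← integral_const_mul, ← integral_sub hi0.integrableOn (hiD _).integrableOn]
          simp only [add_sub_assoc]
  -- The edge is independent of the past together with the current samples, so its probabilities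
  -- factor out.
  have hsplit : ∫ s in A, W (g s) s ∂μ = ∑ e, q e.1 e.2 * ∫ s in A, W e s ∂μ := by
    have e1 : ∀ s, W (g s) s = ∑ e, (g ⁻¹' {e}).indicator (W e) s := fun s => by
      rw [Finset.sum_eq_single (g s) (fun e _ he => ?_) (by simp)]
      · simp
      · have hs : s ∉ g ⁻¹' {e} := fun hs => he (Set.mem_singleton_iff.1 hs).symm
        simp only [Set.indicator_of_notMem hs]
    have hgm : ∀ e, MeasurableSet[m0] (g ⁻¹' {e}) := fun e => hg (measurableSet_singleton e)
    simp only [e1]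
    rw [integral_finsetSum _ fun e _ => ((hWi e).indicator (hgm e)).integrableOn]
    refine Finset.sum_congr rfl fun e _ => ?_
    rw [← hlaw e, setIntegral_indicator (hgm e), Set.inter_comm, ← setIntegral_indicator hA0,
      setIntegral_eq_measureReal_mul_of_indep hm1 hg.comap_le hind
        ((hWm e).stronglyMeasurable.indicator (le_sup_left (a := F) _ hA))
        ((hWi e).indicator hA0) ⟨{e}, measurableSet_singleton e, rfl⟩, integral_indicator hA0]
  have hfin : ∀ e : Fin m × Fin m,
      Integrable (fun s => q e.1 e.2 * (1 + (H e s - 1 / c * D e s))) μ := fun e =>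
    ((integrable_const 1).add ((hHi e).sub ((hDi e).const_mul _))).const_mul _
  calc ∫ s in A, W (g s) s ∂μ = ∑ e, q e.1 e.2 * ∫ s in A, W e s ∂μ := hsplit
    _ ≤ ∑ e, ∫ s in A, q e.1 e.2 * (1 + (H e s - 1 / c * D e s)) ∂μ :=
        Finset.sum_le_sum fun e _ => hedge e
    _ = ∫ s in A, ∑ e, q e.1 e.2 * (1 + (H e s - 1 / c * D e s)) ∂μ :=
        (integral_finsetSum _ fun e _ => (hfin e).integrableOn).symm
    _ ≤ _ := by
        refine setIntegral_mono (integrable_finsetSum _ fun e _ => hfin e).integrableOn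
          (hZi (fun Z => (1 + growth q K B b Z.1) * (1 + ∑ l, ‖Z.2 l - y‖ ^ 2)
            - decrease f X q c b r y Z.2) ?_).integrableOn fun s => ?_
        · have h1 := continuous_growth q K B b
          have h2 := continuous_decrease hfc hX hXc hXne q c b r y
          fun_prop
        · have h1 := sum_edge_estimate_le (K := K) (b := b) (c := c) hCc hCv hf hfd hB hq1 hθ hκ r
            (x s) (hκr (x s)) (a s) hy
          have e1 : ∑ e : Fin m × Fin m, q e.1 e.2 * (1 + (H e s - 1 / c * D e s))
              = 1 + ∑ i, ∑ j, q i j * (H (i, j) s - 1 / c * D (i, j) s) := by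
            rw [Fintype.sum_prod_type]
            simp only [mul_add, mul_one, Finset.sum_add_distrib, hq1]
          have e2 : ∑ i, ∑ j, q i j * (H (i, j) s - 1 / c * D (i, j) s)
              ≤ (1 + growth q K B b (a s)) * (1 + ∑ l, ‖x s l - y‖ ^ 2) - 1
                - decrease f X q c b r y (x s) := by
            unfold growth decrease
            refine le_trans (le_of_eq ?_) h1
            exact Finset.sum_congr rfl fun i _ => Finset.sum_congr rfl fun j _ => by
              simp only [hH, hD]
              ring
          simp only [e1]
          linarith

end Step

/-! ### Convergence along a single path -/

section Path

variable {m d : ℕ} {ι : Fin m → Type*}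

/-- Convergence of a path along which the squared distances to a dense set of minimizers converge
and the decrease is summable. -/
theorem exists_tendsto_of_summable_decrease {f : Fin m → EuclideanSpace ℝ (Fin d) → ℝ}
    {C : ∀ i, ι i → Set (EuclideanSpace ℝ (Fin d))}
    (hCc : ∀ i j, IsClosed (C i j)) (hCv : ∀ i j, Convex ℝ (C i j))
    (hf : ∀ i, Continuous (f i)) {c κ : ℝ} (hc : 0 < c)
    {q : Fin m → Fin m → ℝ} (hq : ∀ i j, 0 ≤ q i j) (hq1 : ∑ i, ∑ j, q i j = 1) (r : Fin m)
    (hκr : ∀ x : Fin m → EuclideanSpace ℝ (Fin d),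
      ∑ l, ‖x l - x r‖ ^ 2 ≤ κ * ∑ i, ∑ j, q i j * ‖x i - x j‖ ^ 2)
    {u : ℕ → EuclideanSpace ℝ (Fin d)} (hu : ∀ n, u n ∈ optimalSet f C)
    (hdense : ∀ z ∈ optimalSet f C, ∀ ε > 0, ∃ n, dist z (u n) < ε)
    {x : ℕ → Fin m → EuclideanSpace ℝ (Fin d)}
    (hconv : ∀ n, ∃ l, Tendsto (fun k => 1 + ∑ i, ‖x k i - u n‖ ^ 2) atTop (𝓝 l))
    (hsum : Summable fun k : ℕ =>
      decrease f (feasibleSet C) q c (1 / ((k : ℝ) + 1)) r (u 0) (x k)) :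
    ∃ z ∈ optimalSet f C, ∀ i, Tendsto (fun k => x k i) atTop (𝓝 z) := by
  set X := feasibleSet C with hXdef
  have hX : IsClosed X := isClosed_feasibleSet hCc
  have hXc : Convex ℝ X := convex_feasibleSet hCv
  have hy : u 0 ∈ X := (hu 0).1
  have hne : X.Nonempty := ⟨u 0, hy⟩
  set z : ℕ → EuclideanSpace ℝ (Fin d) := fun k => proj X (x k r) with hz
  have hzX : ∀ k, z k ∈ X := fun k => proj_mem hX hne _
  have h1 : ∀ k, 0 ≤ ∑ i, ∑ j, q i j * ‖x k i - x k j‖ ^ 2 := fun k =>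
    Finset.sum_nonneg fun i _ => Finset.sum_nonneg fun j _ => mul_nonneg (hq i j) (sq_nonneg _)
  have h2 : ∀ k, 0 ≤ ∑ i, ∑ j, q i j * Metric.infDist (midpoint ℝ (x k i) (x k j)) X ^ 2 :=
    fun k => Finset.sum_nonneg fun i _ => Finset.sum_nonneg fun j _ =>
      mul_nonneg (hq i j) (sq_nonneg _)
  have h3 : ∀ k, 0 ≤ objective f (z k) - objective f (u 0) := fun k =>
    sub_nonneg.2 ((hu 0).2 _ (hzX k))
  have h2' : ∀ k, 0 ≤ 1 / c *
      ∑ i, ∑ j, q i j * Metric.infDist (midpoint ℝ (x k i) (x k j)) X ^ 2 := fun k =>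
    mul_nonneg (by positivity) (h2 k)
  have h3' : ∀ k : ℕ, 0 ≤ 2 * (1 / ((k : ℝ) + 1)) * (objective f (z k) - objective f (u 0)) :=
    fun k => mul_nonneg (by positivity) (h3 k)
  have hs1 : Tendsto (fun k => ∑ i, ∑ j, q i j * ‖x k i - x k j‖ ^ 2) atTop (𝓝 0) := by
    have := (hsum.mul_left 4).of_nonneg_of_le h1 fun k => by
      unfold decrease
      linarith [h1 k, h2' k, h3' k]
    exact this.tendsto_atTop_zero
  have hs2 : Tendsto (fun k => ∑ i, ∑ j, q i j *
      Metric.infDist (midpoint ℝ (x k i) (x k j)) X ^ 2) atTop (𝓝 0) := by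
    have : Summable fun k => 1 / c *
        ∑ i, ∑ j, q i j * Metric.infDist (midpoint ℝ (x k i) (x k j)) X ^ 2 :=
      hsum.of_nonneg_of_le h2' fun k => by
        unfold decrease
        linarith [h1 k, h2' k, h3' k]
    exact ((summable_mul_left_iff (by positivity)).1 this).tendsto_atTop_zero
  have hs3 : Summable fun k : ℕ => 1 / ((k : ℝ) + 1) * (objective f (z k) - objective f (u 0)) :=
    (hsum.mul_left (1 / 2)).of_nonneg_of_le (fun k => mul_nonneg (by positivity) (h3 k))
      fun k => by
        unfold decrease
        have : 1 / ((k : ℝ) + 1) * (objective f (z k) - objective f (u 0))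
            = 1 / 2 * (2 * (1 / ((k : ℝ) + 1)) * (objective f (z k) - objective f (u 0))) := by
          ring
        rw [this]
        linarith [h1 k, h2' k, h3' k]
  -- the agents agree asymptotically
  have hcons : Tendsto (fun k => ∑ l, ‖x k l - x k r‖ ^ 2) atTop (𝓝 0) :=
    squeeze_zero (fun k => Finset.sum_nonneg fun _ _ => sq_nonneg _) (fun k => hκr (x k))
      (by simpa using hs1.const_mul κ)
  have hcons' : ∀ i, Tendsto (fun k => x k i - x k r) atTop (𝓝 0) := fun i => by
    have h : Tendsto (fun k => ‖x k i - x k r‖ ^ 2) atTop (𝓝 0) :=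
      squeeze_zero (fun k => sq_nonneg _) (fun k => Finset.single_le_sum
        (f := fun l => ‖x k l - x k r‖ ^ 2) (fun _ _ => sq_nonneg _) (Finset.mem_univ i)) hcons
    refine tendsto_zero_iff_norm_tendsto_zero.2 ?_
    simpa [Real.sqrt_sq] using h.sqrt
  -- the agents are asymptotically feasible
  have hdist : Tendsto (fun k => x k r - z k) atTop (𝓝 0) := by
    have hle : ∀ k, Metric.infDist (x k r) X ^ 2 ≤ 2 * ∑ l, ‖x k l - x k r‖ ^ 2
        + 2 * ∑ i, ∑ j, q i j * Metric.infDist (midpoint ℝ (x k i) (x k j)) X ^ 2 := fun k => by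
      have hij : ∀ i j, q i j * Metric.infDist (x k r) X ^ 2
          ≤ q i j * (2 * ∑ l, ‖x k l - x k r‖ ^ 2)
            + 2 * (q i j * Metric.infDist (midpoint ℝ (x k i) (x k j)) X ^ 2) := fun i j => by
        have e1 := norm_midpoint_sub_sq_le_sum (x k) i j (x k r)
        have e2 : Metric.infDist (x k r) X ≤ Metric.infDist (midpoint ℝ (x k i) (x k j)) X
            + ‖midpoint ℝ (x k i) (x k j) - x k r‖ := by
          rw [norm_sub_rev, ← dist_eq_norm]
          exact Metric.infDist_le_infDist_add_dist
        have e3 := pow_le_pow_left₀ Metric.infDist_nonneg e2 2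
        have e4 : Metric.infDist (x k r) X ^ 2 ≤ 2 * ∑ l, ‖x k l - x k r‖ ^ 2
            + 2 * Metric.infDist (midpoint ℝ (x k i) (x k j)) X ^ 2 := by
          nlinarith [sq_nonneg (Metric.infDist (midpoint ℝ (x k i) (x k j)) X
            - ‖midpoint ℝ (x k i) (x k j) - x k r‖)]
        nlinarith [mul_le_mul_of_nonneg_left e4 (hq i j)]
      have := Finset.sum_le_sum fun i (_ : i ∈ Finset.univ) =>
        Finset.sum_le_sum fun j (_ : j ∈ Finset.univ) => hij i j
      simpa only [Finset.sum_add_distrib, ← Finset.sum_mul, ← Finset.mul_sum, hq1, one_mul]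
        using this
    have h : Tendsto (fun k => Metric.infDist (x k r) X ^ 2) atTop (𝓝 0) :=
      squeeze_zero (fun k => sq_nonneg _) hle
        (by simpa using (hcons.const_mul 2).add (hs2.const_mul 2))
    refine tendsto_zero_iff_norm_tendsto_zero.2 ?_
    simpa [Real.sqrt_sq, Metric.infDist_nonneg, ← infDist_eq_norm_sub_proj hX hne, hz] using h.sqrt
  -- a subsequence converges to a minimizer
  have hfreq : ∀ n : ℕ, ∃ᶠ k in atTop,
      objective f (z k) - objective f (u 0) < 1 / ((n : ℝ) + 1) := by
    intro n hn
    -- If the gap stayed above `1 / (n + 1)`, the weighted gaps would dominate the harmonic series.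
    have hn' : ∀ᶠ k : ℕ in atTop, ‖1 / ((k : ℝ) + 1)‖
        ≤ ((n : ℝ) + 1) * (1 / ((k : ℝ) + 1) * (objective f (z k) - objective f (u 0))) := by
      filter_upwards [hn] with k hk
      rw [not_lt, div_le_iff₀ (by positivity)] at hk
      rw [Real.norm_of_nonneg (by positivity)]
      calc 1 / ((k : ℝ) + 1) ≤ 1 / ((k : ℝ) + 1)
            * ((objective f (z k) - objective f (u 0)) * ((n : ℝ) + 1)) :=
            le_mul_of_one_le_right (by positivity) hk
        _ = _ := by ring
    have hsummable : Summable fun k : ℕ => 1 / ((k : ℝ) + 1) :=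
      Summable.of_norm_bounded_eventually_nat (hs3.mul_left _) hn'
    refine Real.not_summable_one_div_natCast ((summable_nat_add_iff 1).1 (hsummable.congr ?_))
    intro k
    push_cast
    rfl
  obtain ⟨φ, hφ, hφlt⟩ := extraction_forall_of_frequently hfreq
  have hbdd : ∃ M, ∀ k, ‖z k - u 0‖ ^ 2 ≤ M := by
    obtain ⟨l, hl⟩ := hconv 0
    obtain ⟨M, hM⟩ := hl.bddAbove_range
    refine ⟨M, fun k => ?_⟩
    have e1 : 1 + ∑ i, ‖x k i - u 0‖ ^ 2 ≤ M := hM ⟨k, rfl⟩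
    have e2 : ‖x k r - u 0‖ ^ 2 ≤ ∑ i, ‖x k i - u 0‖ ^ 2 := Finset.single_le_sum
      (f := fun l => ‖x k l - u 0‖ ^ 2) (fun _ _ => sq_nonneg _) (Finset.mem_univ r)
    have e3 := norm_proj_sub_sq_le hX hXc (x k r) hy
    have e4 := sq_nonneg ‖proj X (x k r) - x k r‖
    simp only [hz]
    linarith
  obtain ⟨M, hM⟩ := hbdd
  have hmem : ∀ n, z (φ n) ∈ Metric.closedBall (u 0) (√M) := fun n => by
    rw [Metric.mem_closedBall, dist_eq_norm]
    exact Real.le_sqrt_of_sq_le (hM _)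
  obtain ⟨zs, -, ψ, hψ, hlim⟩ := tendsto_subseq_of_bounded Metric.isBounded_closedBall hmem
  set χ := φ ∘ ψ with hχ
  have hχmono : StrictMono χ := hφ.comp hψ
  have hlim' : Tendsto (fun n => z (χ n)) atTop (𝓝 zs) := hlim
  have hzs : zs ∈ optimalSet f C := by
    refine ⟨hX.mem_of_tendsto hlim' (Eventually.of_forall fun n => hzX _), fun v hv => ?_⟩
    refine le_trans ?_ ((hu 0).2 v hv)
    have hcont := ((continuous_objective hf).tendsto zs).comp hlim'
    have hright : Tendsto (fun n => objective f (u 0) + 1 / ((ψ n : ℝ) + 1)) atTop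
        (𝓝 (objective f (u 0) + 0)) :=
      tendsto_const_nhds.add
        ((tendsto_one_div_add_atTop_nhds_zero_nat (𝕜 := ℝ)).comp hψ.tendsto_atTop)
    rw [add_zero] at hright
    refine le_of_tendsto_of_tendsto' hcont hright fun n => ?_
    have := hφlt (ψ n)
    simp only [Function.comp_apply, hχ]
    linarith
  have hxlim : ∀ i, Tendsto (fun n => x (χ n) i) atTop (𝓝 zs) := fun i => by
    have e1 := (hcons' i).comp hχmono.tendsto_atTop
    have e2 := hdist.comp hχmono.tendsto_atTop
    have := (e1.add e2).add hlim'
    rw [add_zero, zero_add] at this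
    refine this.congr fun n => ?_
    simp only [Function.comp_apply]
    abel
  refine ⟨zs, hzs, fun i => Metric.tendsto_atTop.2 fun ε hε => ?_⟩
  -- With `‖zs - u n‖ < δ`, the limit of the summed squares is below `(m + 1) * δ ^ 2`. Each agent
  -- is then eventually within `(m + 1) * δ` of `u n`, and one more `δ` reaches `zs`.
  set δ := ε / (m + 2) with hδ
  have hδ0 : 0 < δ := by positivity
  obtain ⟨n, hn⟩ := hdense zs hzs δ hδ0
  obtain ⟨l, hl⟩ := hconv n
  -- The limit exists along the full sequence, so the subsequence may be used to compute it.
  have hl' : l = 1 + ∑ _i : Fin m, ‖zs - u n‖ ^ 2 := by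
    refine tendsto_nhds_unique (hl.comp hχmono.tendsto_atTop) ?_
    exact tendsto_const_nhds.add (tendsto_finsetSum _ fun i _ =>
      (((hxlim i).sub_const (u n)).norm.pow 2))
  have hnorm : ‖zs - u n‖ < δ := by rwa [← dist_eq_norm]
  have hlt : l < 1 + (m + 1) * δ ^ 2 := by
    rw [hl']
    simp only [Finset.sum_const, Finset.card_univ, Fintype.card_fin, nsmul_eq_mul]
    have : ‖zs - u n‖ ^ 2 ≤ δ ^ 2 := pow_le_pow_left₀ (norm_nonneg _) hnorm.le 2
    have : (m : ℝ) * ‖zs - u n‖ ^ 2 ≤ m * δ ^ 2 := by gcongr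
    nlinarith [sq_pos_of_pos hδ0]
  obtain ⟨N, hN⟩ := eventually_atTop.1 (hl.eventually (gt_mem_nhds hlt))
  refine ⟨N, fun k hk => ?_⟩
  have e1 := hN k hk
  have e2 : ‖x k i - u n‖ ^ 2 ≤ ∑ i, ‖x k i - u n‖ ^ 2 := Finset.single_le_sum
    (f := fun l => ‖x k l - u n‖ ^ 2) (fun _ _ => sq_nonneg _) (Finset.mem_univ i)
  have hm0 : (0 : ℝ) ≤ m := Nat.cast_nonneg m
  have e3 : ‖x k i - u n‖ < (m + 1) * δ := by
    refine lt_of_pow_lt_pow_left₀ 2 (by positivity) ?_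
    nlinarith [mul_nonneg (mul_nonneg hm0 (by positivity : (0 : ℝ) ≤ (m : ℝ) + 1))
      (sq_nonneg δ)]
  calc dist (x k i) zs ≤ dist (x k i) (u n) + dist (u n) zs := dist_triangle _ _ _
    _ < (m + 1) * δ + δ := by
        rw [dist_eq_norm, dist_comm, dist_eq_norm]
        exact add_lt_add e3 hnorm
    _ = ε := by
        rw [hδ]
        field_simp
        ring

end Path

/-! ### The filtration of past events -/

section History

variable {m d : ℕ} {ι : Fin m → Type*} {S : Type*}

theorem measurable_apply_of_finite [MeasurableSpace S] {α Y : Type*} [Finite α]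
    [MeasurableSpace α] [MeasurableSingletonClass α] [MeasurableSpace Y] {φ : α → S → Y}
    (hφ : ∀ e, Measurable (φ e)) {g : S → α} (hg : Measurable g) :
    Measurable fun s => φ (g s) s :=
  (measurable_from_prod_countable_right (f := fun p : α × S => φ p.1 p.2) hφ).comp
    (hg.prodMk measurable_id)

theorem measurable_stepsize [MeasurableSpace S] {g : ℕ → S → Fin m × Fin m} {k : ℕ}
    (hg : ∀ t < k, Measurable (g t)) :
    Measurable fun s l => 1 / ((updateCount (fun t => g t s) l k : ℝ) + 1) := by
  refine measurable_pi_lambda _ fun l => ?_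
  have h : Measurable fun s => (updateCount (fun t => g t s) l k : ℝ) := by
    have e : (fun s => (updateCount (fun t => g t s) l k : ℝ)) = fun s =>
        ∑ t ∈ Finset.range k, if l = (g t s).1 ∨ l = (g t s).2 then (1 : ℝ) else 0 := by
      funext s
      simp [updateCount, Finset.sum_boole]
    rw [e]
    refine Finset.measurable_fun_sum _ fun t ht => ?_
    exact (measurable_of_finite fun e : Fin m × Fin m =>
      if l = e.1 ∨ l = e.2 then (1 : ℝ) else 0).comp (hg t (Finset.mem_range.1 ht))
  exact measurable_const.div (h.add_const 1)

theorem exists_norm_iterate_le {x₀ : S → Fin m → EuclideanSpace ℝ (Fin d)}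
    {g : ℕ → S → Fin m × Fin m} {Ω : ℕ → ∀ i, S → ι i}
    {f : Fin m → EuclideanSpace ℝ (Fin d) → ℝ}
    {C : ∀ i, ι i → Set (EuclideanSpace ℝ (Fin d))}
    (hCc : ∀ i j, IsClosed (C i j)) (hCv : ∀ i j, Convex ℝ (C i j)) {B L : ℝ} (hL0 : 0 ≤ L)
    (hB : ∀ i, ∀ x ∈ feasibleSet C, ‖gradient (f i) x‖ ≤ B)
    (hL : ∀ i x y, ‖gradient (f i) x - gradient (f i) y‖ ≤ L * ‖x - y‖)
    {y : EuclideanSpace ℝ (Fin d)} (hy : y ∈ feasibleSet C) {R : ℝ}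
    (hR : ∀ s l, ‖x₀ s l‖ ≤ R) (k : ℕ) :
    ∃ R', ∀ s l, ‖iterate f C (x₀ s) (fun t => g t s) (fun t j => Ω t j s) k l‖ ≤ R' := by
  induction k with
  | zero => exact ⟨R, hR⟩
  | succ k ih =>
    obtain ⟨R', h⟩ := ih
    refine ⟨R' + 2 * ‖y‖ + B + L * (R' + ‖y‖), fun s l => ?_⟩
    rw [iterate_succ_eq_edgeStep]
    refine norm_edgeStep_le hCc hCv hL0 hB hL (fun l => by positivity) (fun l => ?_) hy _ _ _
      (h s) l
    have h0 : (0 : ℝ) ≤ updateCount (fun t => g t s) l k := Nat.cast_nonneg _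
    exact (div_le_one (by positivity)).2 (by linarith)

/-- The information available before tick `k`. -/
abbrev history [∀ i, MeasurableSpace (ι i)] (x₀ : S → Fin m → EuclideanSpace ℝ (Fin d))
    (g : ℕ → S → Fin m × Fin m) (Ω : ℕ → ∀ i, S → ι i) (k : ℕ) : MeasurableSpace S :=
  samplePast Ω k ⊔ (MeasurableSpace.comap x₀ inferInstance ⊔
    ⨆ (t : ℕ) (_ : t < k), MeasurableSpace.comap (g t) inferInstance)

variable [∀ i, MeasurableSpace (ι i)] {x₀ : S → Fin m → EuclideanSpace ℝ (Fin d)}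
  {g : ℕ → S → Fin m × Fin m} {Ω : ℕ → ∀ i, S → ι i}

theorem samplePast_mono : Monotone (samplePast Ω) := fun _ _ h =>
  iSup_mono fun _ => iSup_mono' fun ht => ⟨ht.trans_le h, le_rfl⟩

theorem history_mono : Monotone (history x₀ g Ω) := fun _ _ h =>
  sup_le_sup (samplePast_mono h)
    (sup_le_sup le_rfl (iSup_mono fun _ => iSup_mono' fun ht => ⟨ht.trans_le h, le_rfl⟩))

theorem measurable_gossip_history {t k : ℕ} (h : t < k) : Measurable[history x₀ g Ω k] (g t) :=
  (comap_measurable (g t)).mono (le_sup_of_le_right (le_sup_of_le_right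
    (le_iSup₂_of_le t h le_rfl))) le_rfl

theorem measurable_sample_history {t k : ℕ} (h : t < k) (i : Fin m) :
    Measurable[history x₀ g Ω k] (Ω t i) :=
  (comap_measurable (Ω t i)).mono (le_sup_of_le_left
    (le_iSup₂_of_le t h (le_iSup_of_le i le_rfl))) le_rfl

theorem measurable_initial_history (k : ℕ) : Measurable[history x₀ g Ω k] x₀ :=
  (comap_measurable x₀).mono (le_sup_of_le_right le_sup_left) le_rfl

theorem history_le [m0 : MeasurableSpace S] (hx₀ : Measurable x₀) (hg : ∀ k, Measurable (g k))
    (hΩ : ∀ k i, Measurable (Ω k i)) (k : ℕ) : history x₀ g Ω k ≤ m0 :=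
  sup_le (iSup₂_le fun t _ => iSup_le fun i => (hΩ t i).comap_le)
    (sup_le hx₀.comap_le (iSup₂_le fun t _ => (hg t).comap_le))

theorem measurable_iterate {f : Fin m → EuclideanSpace ℝ (Fin d) → ℝ}
    {C : ∀ i, ι i → Set (EuclideanSpace ℝ (Fin d))}
    (hCc : ∀ i j, IsClosed (C i j)) (hCv : ∀ i j, Convex ℝ (C i j))
    (hCm : ∀ i x, Measurable fun j => Metric.infDist x (C i j))
    (hne : ∀ i j, (C i j).Nonempty) (hgrad : ∀ i, Continuous (gradient (f i))) (k : ℕ) :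
    Measurable[history x₀ g Ω k] fun s =>
      iterate f C (x₀ s) (fun t => g t s) (fun t j => Ω t j s) k := by
  induction k with
  | zero => exact measurable_initial_history 0
  | succ k ih =>
    simp only [iterate_succ_eq_edgeStep]
    let := history x₀ g Ω (k + 1)
    have hx : Measurable fun s => iterate f C (x₀ s) (fun t => g t s) (fun t j => Ω t j s) k :=
      ih.mono (history_mono k.le_succ) le_rfl
    have ha : Measurable fun s l => 1 / ((updateCount (fun t => g t s) l k : ℝ) + 1) :=
      measurable_stepsize fun t ht => measurable_gossip_history (ht.trans k.lt_succ_self)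
    have hw : Measurable fun s j => Ω k j s :=
      measurable_pi_lambda _ fun i => measurable_sample_history k.lt_succ_self i
    exact measurable_apply_of_finite (fun e : Fin m × Fin m =>
      measurable_edgeStep hCc hCv hCm hne hgrad ha e.1 e.2 hw hx)
      (measurable_gossip_history k.lt_succ_self)

end History

/-! ### Independence of the next edge and the next samples from the past -/

section Independence

variable {m d : ℕ} {ι : Fin m → Type*} {S : Type*} [m0 : MeasurableSpace S] {μ : Measure S}
  [IsProbabilityMeasure μ] [∀ i, MeasurableSpace (ι i)]
  {x₀ : S → Fin m → EuclideanSpace ℝ (Fin d)} {g : ℕ → S → Fin m × Fin m}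
  {Ω : ℕ → ∀ i, S → ι i}

/-- The next pair is independent of the earlier pairs; two regroupings attach first all samples,
then the initial points. -/
theorem indep_history_sup_sample_gossip (hx₀ : Measurable x₀) (hg : ∀ k, Measurable (g k))
    (hΩ : ∀ k i, Measurable (Ω k i)) (hgi : iIndepFun g μ)
    (hind : IndepFun (fun s k => g k s) (fun s k i => Ω k i s) μ)
    (hind₀ : IndepFun x₀ (fun s => (fun k => g k s, fun k i => Ω k i s)) μ) (k : ℕ) :
    Indep (history x₀ g Ω k ⊔ MeasurableSpace.comap (fun s i => Ω k i s) inferInstance)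
      (MeasurableSpace.comap (g k) inferInstance) μ := by
  have hΩm : Measurable fun s k i => Ω k i s :=
    measurable_pi_lambda _ fun k => measurable_pi_lambda _ fun i => hΩ k i
  set p : S → (Finset.range k → Fin m × Fin m) := fun s t => g t s with hp
  have hpm : Measurable p := measurable_pi_lambda _ fun t => hg t
  have h1 : IndepFun (g k) p μ := by
    have := hgi.indepFun_finset {k} (Finset.range k) (by simp) hg
    have hk : Measurable fun v : ({k} : Finset ℕ) → Fin m × Fin m => v ⟨k, by simp⟩ :=
      measurable_pi_apply _
    exact this.comp hk measurable_id
  have hsel : Measurable fun v : ℕ → Fin m × Fin m =>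
      (v k, fun t : Finset.range k => v t) := by
    refine (measurable_pi_apply k).prodMk (measurable_pi_lambda _ fun t => measurable_pi_apply _)
  have h2 : IndepFun (fun s => (g k s, p s)) (fun s k i => Ω k i s) μ :=
    hind.comp hsel measurable_id
  have h3 := indepFun_prodMk_of_indepFun_prodMk (hg k) hpm hΩm h1 h2
  have hsel2 : Measurable fun v : (ℕ → Fin m × Fin m) × (ℕ → ∀ i, ι i) =>
      (v.1 k, ((fun t : Finset.range k => v.1 t), v.2)) :=
    ((measurable_pi_apply k).comp measurable_fst).prodMk
      ((measurable_pi_lambda _ fun t => (measurable_pi_apply _).comp measurable_fst).prodMk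
        measurable_snd)
  have h4 : IndepFun (fun s => (g k s, (p s, fun k i => Ω k i s))) x₀ μ :=
    hind₀.symm.comp hsel2 measurable_id
  have h5 := indepFun_prodMk_of_indepFun_prodMk (hg k) (hpm.prodMk hΩm) hx₀ h3 h4
  refine indep_of_indep_of_le_left h5.symm ?_
  set Z : S → ((Finset.range k → Fin m × Fin m) × (ℕ → ∀ i, ι i)) ×
    (Fin m → EuclideanSpace ℝ (Fin d)) := fun s => ((p s, fun k i => Ω k i s), x₀ s) with hZ
  change _ ≤ MeasurableSpace.comap Z inferInstance
  have hZm : Measurable[MeasurableSpace.comap Z inferInstance] Z := comap_measurable Z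
  have hΩZ : ∀ t i, Measurable[MeasurableSpace.comap Z inferInstance] (Ω t i) := fun t i =>
    (measurable_pi_apply i).comp ((measurable_pi_apply t).comp
      (measurable_snd.comp (measurable_fst.comp hZm)))
  refine sup_le (sup_le (iSup₂_le fun t _ => iSup_le fun i => (hΩZ t i).comap_le)
    (sup_le (measurable_snd.comp hZm).comap_le (iSup₂_le fun t ht => ?_))) ?_
  · have : Measurable[MeasurableSpace.comap Z inferInstance] (g t) :=
      (measurable_pi_apply (⟨t, Finset.mem_range.2 ht⟩ : Finset.range k)).comp
        (measurable_fst.comp (measurable_fst.comp hZm))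
    exact this.comap_le
  · have : Measurable[MeasurableSpace.comap Z inferInstance] fun s i => Ω k i s :=
      (measurable_pi_apply k).comp (measurable_snd.comp (measurable_fst.comp hZm))
    exact this.comap_le

/-- Past pairs and initial points are independent of all samples, so the regularity assumption
carries over to the full history. -/
theorem condExp_samplePast_eq_condExp_history (hx₀ : Measurable x₀) (hg : ∀ k, Measurable (g k))
    (hΩ : ∀ k i, Measurable (Ω k i))
    (hind : IndepFun (fun s k => g k s) (fun s k i => Ω k i s) μ)
    (hind₀ : IndepFun x₀ (fun s => (fun k => g k s, fun k i => Ω k i s)) μ) (k : ℕ) (i : Fin m)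
    {φ : ι i → ℝ} (hφ : Measurable φ) (hi : Integrable (fun s => φ (Ω k i s)) μ) :
    μ[fun s => φ (Ω k i s) | samplePast Ω k] =ᵐ[μ] μ[fun s => φ (Ω k i s) | history x₀ g Ω k] := by
  have hΩm : Measurable fun s k i => Ω k i s :=
    measurable_pi_lambda _ fun k => measurable_pi_lambda _ fun i => hΩ k i
  have hgm : Measurable fun s k => g k s := measurable_pi_lambda _ hg
  have h1 := indepFun_prodMk_of_indepFun_prodMk hΩm hgm hx₀ hind.symm
    (hind₀.symm.comp measurable_swap measurable_id)
  set Z : S → (ℕ → Fin m × Fin m) × (Fin m → EuclideanSpace ℝ (Fin d)) :=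
    fun s => (fun k => g k s, x₀ s) with hZ
  set Y : S → ℕ → ∀ i, ι i := fun s k i => Ω k i s with hY
  have hYm : Measurable[MeasurableSpace.comap Y inferInstance] Y := comap_measurable Y
  have hZm : Measurable[MeasurableSpace.comap Z inferInstance] Z := comap_measurable Z
  have hΩY : ∀ t i, Measurable[MeasurableSpace.comap Y inferInstance] (Ω t i) := fun t i =>
    (measurable_pi_apply i).comp ((measurable_pi_apply t).comp hYm)
  have hle : MeasurableSpace.comap x₀ inferInstance ⊔
      ⨆ (t : ℕ) (_ : t < k), MeasurableSpace.comap (g t) inferInstance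
      ≤ MeasurableSpace.comap Z inferInstance := by
    refine sup_le (measurable_snd.comp hZm).comap_le (iSup₂_le fun t _ => ?_)
    have : Measurable[MeasurableSpace.comap Z inferInstance] (g t) :=
      (measurable_pi_apply t).comp (measurable_fst.comp hZm)
    exact this.comap_le
  have hind' : Indep (MeasurableSpace.comap Y inferInstance)
      (MeasurableSpace.comap x₀ inferInstance ⊔
        ⨆ (t : ℕ) (_ : t < k), MeasurableSpace.comap (g t) inferInstance) μ :=
    indep_of_indep_of_le_right h1 hle
  refine condExp_sup_of_indep (m3 := MeasurableSpace.comap Y inferInstance)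
    (iSup₂_le fun t _ => iSup_le fun i => (hΩY t i).comap_le)
    (hle.trans (hgm.prodMk hx₀).comap_le) hΩm.comap_le hind' ?_ hi
  exact (hφ.comp (hΩY k i)).stronglyMeasurable

end Independence

/-- Almost sure convergence for bounded initial points. -/
theorem ae_exists_tendsto_iterate_of_bounded
    {m d : ℕ} {ι : Fin m → Type*} [∀ i, MeasurableSpace (ι i)]
    {S : Type*} [m0 : MeasurableSpace S] {μ : Measure S} [IsProbabilityMeasure μ]
    {f : Fin m → EuclideanSpace ℝ (Fin d) → ℝ}
    {C : ∀ i, ι i → Set (EuclideanSpace ℝ (Fin d))}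
    {x₀ : S → Fin m → EuclideanSpace ℝ (Fin d)} {g : ℕ → S → Fin m × Fin m}
    {Ω : ℕ → ∀ i, S → ι i} (hx₀ : Measurable x₀) (hg : ∀ k, Measurable (g k))
    (hΩ : ∀ k i, Measurable (Ω k i)) {G : SimpleGraph (Fin m)} (hG : G.Connected)
    {q : Fin m → Fin m → ℝ} (hq : ∀ i j, 0 ≤ q i j) (hqpos : ∀ i j, G.Adj i j → 0 < q i j)
    (hq0 : ∀ i, q i i = 0) (hq1 : ∑ i, ∑ j, q i j = 1) (hqrow : ∀ i, 0 < ∑ j, q i j)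
    (hlaw : ∀ k e, μ.real (g k ⁻¹' {e}) = q e.1 e.2) (hgi : iIndepFun g μ)
    (hind : IndepFun (fun s k => g k s) (fun s k i => Ω k i s) μ)
    (hind₀ : IndepFun x₀ (fun s => (fun k => g k s, fun k i => Ω k i s)) μ)
    (hCc : ∀ i j, IsClosed (C i j)) (hCv : ∀ i j, Convex ℝ (C i j))
    (hCm : ∀ i x, Measurable fun j => Metric.infDist x (C i j))
    (hf : ∀ i, ConvexOn ℝ Set.univ (f i)) (hfd : ∀ i, Differentiable ℝ (f i)) {L : ℝ}
    (hL0 : 0 ≤ L) (hL : ∀ i x y, ‖gradient (f i) x - gradient (f i) y‖ ≤ L * ‖x - y‖) {B : ℝ}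
    (hB : ∀ i, ∀ x ∈ feasibleSet C, ‖gradient (f i) x‖ ≤ B) {c : ℝ} (hc : 0 < c)
    (hreg : ∀ (k : ℕ) (i : Fin m) (x : EuclideanSpace ℝ (Fin d)), ∀ᵐ s ∂μ,
      Metric.infDist x (feasibleSet C) ^ 2 ≤
        c * (μ[fun s' => Metric.infDist x (C i (Ω k i s')) ^ 2 | samplePast Ω k]) s)
    (hopt : (optimalSet f C).Nonempty) {R : ℝ} (hR : ∀ s l, ‖x₀ s l‖ ≤ R) :
    ∀ᵐ s ∂μ, ∃ z ∈ optimalSet f C, ∀ i, Tendsto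
      (fun k => iterate f C (x₀ s) (fun t => g t s) (fun t j => Ω t j s) k i) atTop (𝓝 z) := by
  obtain ⟨r⟩ := hG.nonempty
  obtain ⟨κ, hκ, hκr⟩ := exists_sum_norm_sub_sq_le (d := d) hG hq hqpos r
  have : Nonempty (optimalSet f C) := hopt.to_subtype
  set u : ℕ → EuclideanSpace ℝ (Fin d) :=
    fun n => (TopologicalSpace.denseSeq (optimalSet f C) n : EuclideanSpace ℝ (Fin d)) with hu_def
  have hu : ∀ n, u n ∈ optimalSet f C := fun n => Subtype.coe_prop _
  have hdense : ∀ z ∈ optimalSet f C, ∀ ε > 0, ∃ n, dist z (u n) < ε := fun z hz ε hε =>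
    (TopologicalSpace.denseRange_denseSeq (optimalSet f C)).exists_dist_lt ⟨z, hz⟩ hε
  have hXne : (feasibleSet C).Nonempty := ⟨u 0, (hu 0).1⟩
  have hX : IsClosed (feasibleSet C) := isClosed_feasibleSet hCc
  have hCne : ∀ i j, (C i j).Nonempty := fun i j => hXne.mono (feasibleSet_subset i j)
  have hgrad : ∀ i, Continuous (gradient (f i)) := fun i =>
    (LipschitzWith.of_dist_le_mul (K := ⟨L, hL0⟩) fun x y => by
      rw [dist_eq_norm, dist_eq_norm]; exact hL i x y).continuous
  have hfc : ∀ i, Continuous (f i) := fun i => (hfd i).continuous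
  have hB0 : 0 ≤ B := (norm_nonneg _).trans (hB r _ (hu 0).1)
  set K := 4 * c * B ^ 2 + B ^ 2 / (1 / (8 * κ)) + 8 * B ^ 2 + 8 * L ^ 2 with hK
  have hK0 : 0 ≤ K := by positivity
  set x : ℕ → S → Fin m → EuclideanSpace ℝ (Fin d) :=
    fun k s => iterate f C (x₀ s) (fun t => g t s) (fun t j => Ω t j s) k with hx
  set a : ℕ → S → Fin m → ℝ :=
    fun k s l => 1 / ((updateCount (fun t => g t s) l k : ℝ) + 1) with ha
  let F : Filtration ℕ m0 := ⟨history x₀ g Ω, history_mono, history_le hx₀ hg hΩ⟩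
  have hxF : ∀ k, Measurable[F k] (x k) := fun k =>
    measurable_iterate hCc hCv hCm hCne hgrad k
  have haF : ∀ k, Measurable[F k] (a k) := fun k =>
    @measurable_stepsize _ _ (F k) _ _ fun t ht => measurable_gossip_history ht
  have ha0 : ∀ k s l, 0 ≤ a k s l := fun k s l => by simp only [ha]; positivity
  have ha1 : ∀ k s l, a k s l ≤ 1 := fun k s l => by
    have h0 : (0 : ℝ) ≤ updateCount (fun t => g t s) l k := Nat.cast_nonneg _
    exact (div_le_one (by positivity)).2 (by linarith)
  have hregF : ∀ k i y, ∀ᵐ s ∂μ, Metric.infDist y (feasibleSet C) ^ 2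
      ≤ c * (μ[fun s' => Metric.infDist y (C i (Ω k i s')) ^ 2 | F k]) s := fun k i y => by
    have hmeas : Measurable fun j => Metric.infDist y (C i j) ^ 2 := (hCm i y).pow_const 2
    have hi : Integrable (fun s => Metric.infDist y (C i (Ω k i s)) ^ 2) μ := by
      refine Integrable.of_bound (hmeas.comp (hΩ k i)).aestronglyMeasurable
        (Metric.infDist y (feasibleSet C) ^ 2) (ae_of_all _ fun s => ?_)
      rw [Real.norm_of_nonneg (sq_nonneg _)]
      exact pow_le_pow_left₀ Metric.infDist_nonneg
        (Metric.infDist_le_infDist_of_subset (feasibleSet_subset i _) hXne) 2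
    filter_upwards [hreg k i y, condExp_samplePast_eq_condExp_history hx₀ hg hΩ hind hind₀ k i
      hmeas hi] with s h1 h2
    exact h2 ▸ h1
  have hstep : ∀ k s, x (k + 1) s
      = edgeStep f C (a k s) (g k s).1 (g k s).2 (fun i => Ω k i s) (x k s) := fun k s =>
    iterate_succ_eq_edgeStep ..
  have hbound : ∀ k, ∃ R', ∀ s l, ‖x k s l‖ ≤ R' := fun k =>
    exists_norm_iterate_le hCc hCv hL0 hB hL (hu 0).1 hR k
  have hint : ∀ k (ψ : (Fin m → ℝ) × (Fin m → EuclideanSpace ℝ (Fin d)) → ℝ), Continuous ψ →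
      Integrable (fun s => ψ (a k s, x k s)) μ := fun k ψ hψ => by
    obtain ⟨R', hR'⟩ := hbound k
    have hm : Measurable[m0] fun s => (a k s, x k s) :=
      ((haF k).mono (F.le k) le_rfl).prodMk ((hxF k).mono (F.le k) le_rfl)
    refine integrable_comp_of_bounded hm (R := max 1 R') (fun s => ?_) hψ
    refine max_le_max ((pi_norm_le_iff_of_nonneg zero_le_one).2 fun l => ?_)
      ((pi_norm_le_iff_of_nonneg ((norm_nonneg _).trans (hR' s r))).2 (hR' s))
    rw [Real.norm_of_nonneg (ha0 k s l)]
    exact ha1 k s l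
  -- the Robbins–Siegmund theorem applied to the squared distance to a minimizer
  have hRS : ∀ n, ∀ᵐ s ∂μ, Summable (fun k : ℕ => growth q K B (1 / ((k : ℝ) + 1)) (a k s)) →
      (∃ l, Tendsto (fun k => 1 + ∑ i, ‖x k s i - u n‖ ^ 2) atTop (𝓝 l)) ∧
      Summable fun k : ℕ =>
        decrease f (feasibleSet C) q c (1 / ((k : ℝ) + 1)) r (u n) (x k s) := by
    intro n
    have hV : Continuous fun x : Fin m → EuclideanSpace ℝ (Fin d) =>
        1 + ∑ i, ‖x i - u n‖ ^ 2 := by fun_prop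
    have hdec : ∀ k : ℕ, Continuous
        (decrease f (feasibleSet C) q c (1 / ((k : ℝ) + 1)) r (u n)) := fun k =>
      continuous_decrease hfc hX (convex_feasibleSet hCv) hXne _ _ _ _ _
    have hgr : ∀ k : ℕ, Continuous (growth q K B (1 / ((k : ℝ) + 1))) := fun k =>
      continuous_growth _ _ _ _
    refine robbins_siegmund (F := F) (fun k => hV.measurable.comp (hxF k))
      (fun k => (hdec k).measurable.comp (hxF k)) (fun k => (hgr k).measurable.comp (haF k))
      (fun k s => by positivity)
      (fun k s => decrease_nonneg hX hq hc (by positivity) r (hu n).1 (hu n).2 _)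
      (fun k s => growth_nonneg hq hK0 hB0 _ _)
      (fun k => hint k _ (hV.comp continuous_snd))
      (fun k => hint k _ ((hdec k).comp continuous_snd))
      (fun k => hint k (fun Z => growth q K B (1 / ((k : ℝ) + 1)) Z.1
        * (1 + ∑ i, ‖Z.2 i - u n‖ ^ 2))
        (((hgr k).comp continuous_fst).mul (hV.comp continuous_snd))) fun k A hA => ?_
    obtain ⟨R', hR'⟩ := hbound k
    simp only [hstep]
    exact setIntegral_edgeStep_le hCc hCv hCm hf hfd hL0 hB hL hc hκ hq hq0 hq1 r hκr (F.le k)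
      (hg k) (hlaw k) (measurable_pi_lambda _ fun i => hΩ k i)
      (indep_history_sup_sample_gossip hx₀ hg hΩ hgi hind hind₀ k) (hregF k) (haF k) (ha0 k)
      (ha1 k) (hxF k) hR' (hu n).1 _ hA
  have hcount : ∀ᵐ s ∂μ, ∀ i, _ := ae_all_iff.2 fun i =>
    ae_summable_inv_updateCount hg hq0 hlaw hgi i (by
      rw [Finset.sum_add_distrib]
      exact add_pos_of_pos_of_nonneg (hqrow i) (Finset.sum_nonneg fun j _ => hq j i))
  filter_upwards [ae_all_iff.2 hRS, hcount] with s hs hsc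
  have hgrowth : Summable fun k : ℕ => growth q K B (1 / ((k : ℝ) + 1)) (a k s) :=
    ((summable_sum fun i _ => (hsc i).2.mul_left _).mul_left K).add
      ((summable_sum fun i _ => (hsc i).1).mul_left (2 * B))
  exact exists_tendsto_of_summable_decrease hCc hCv hfc hc hq hq1 r hκr hu hdense
    (fun n => (hs n hgrowth).1) (hs 0 hgrowth).2

end GRP

/-! ### Truncation of the initial points and measurability of the limit -/

theorem proposition1
    {m d : ℕ} {ι : Fin m → Type*} [∀ i, MeasurableSpace (ι i)]
    -- the probability space
    {S : Type*} [MeasurableSpace S] (μ : Measure S) [IsProbabilityMeasure μ]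
    -- the problem: local objectives and component constraint sets
    (f : Fin m → EuclideanSpace ℝ (Fin d) → ℝ)
    (C : ∀ i, ι i → Set (EuclideanSpace ℝ (Fin d)))
    -- the random data: initial points, waking agent, contacted neighbor, constraint samples
    (x₀ : S → Fin m → EuclideanSpace ℝ (Fin d))
    (I J : ℕ → S → Fin m)
    (Ω : ℕ → ∀ i, S → ι i)
    (hx₀ : Measurable x₀)
    (hI : ∀ k, Measurable (I k)) (hJ : ∀ k, Measurable (J k))
    (hΩ : ∀ k i, Measurable (Ω k i))
    -- the network: connected graph and a stochastic matrix that is positive exactly on its edges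
    (G : SimpleGraph (Fin m)) (hG : G.Connected)
    (P : Matrix (Fin m) (Fin m) ℝ)
    (hPpos : ∀ i j, G.Adj i j → 0 < P i j)
    (hPzero : ∀ i j, ¬ G.Adj i j → P i j = 0)
    (hPsum : ∀ i, ∑ j, P i j = 1)
    -- iid gossip: a uniformly chosen agent wakes up and contacts a neighbor according to `P`
    (hgossip_law : ∀ k i j, μ.real {s | I k s = i ∧ J k s = j} = (1 / (m : ℝ)) * P i j)
    (hgossip_indep : iIndepFun (fun k s => (I k s, J k s)) μ)
    -- initial points, gossip and constraint samples are mutually independent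
    (hindep : IndepFun (fun s k => (I k s, J k s)) (fun s k i => Ω k i s) μ)
    (hindep₀ : IndepFun x₀ (fun s => (fun k => (I k s, J k s), fun k i => Ω k i s)) μ)
    -- the component sets are closed and convex, and depend measurably on their index
    (hCclosed : ∀ i j, IsClosed (C i j)) (hCconvex : ∀ i j, Convex ℝ (C i j))
    (hCmeas : ∀ i x, Measurable fun j => Metric.infDist x (C i j))
    -- the objectives are convex, with Lipschitz gradients that are bounded on the feasible set
    (hfconvex : ∀ i, ConvexOn ℝ Set.univ (f i))
    (hfdiff : ∀ i, Differentiable ℝ (f i))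
    (L : Fin m → ℝ)
    (hfLip : ∀ i x y, ‖gradient (f i) x - gradient (f i) y‖ ≤ L i * ‖x - y‖)
    (Gf : ℝ) (hfbdd : ∀ i, ∀ x ∈ GRP.feasibleSet C, ‖gradient (f i) x‖ ≤ Gf)
    -- regularity of the constraint sets
    (c : ℝ) (hc : 0 < c)
    (hreg : ∀ (k : ℕ) (i : Fin m) (x : EuclideanSpace ℝ (Fin d)), ∀ᵐ s ∂μ,
      Metric.infDist x (GRP.feasibleSet C) ^ 2 ≤
        c * (μ[fun s' => Metric.infDist x (C i (Ω k i s')) ^ 2 | GRP.samplePast Ω k]) s)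
    -- existence of an optimal solution
    (hopt : (GRP.optimalSet f C).Nonempty) :
    ∃ xstar : S → EuclideanSpace ℝ (Fin d), Measurable xstar ∧
      ∀ᵐ s ∂μ, xstar s ∈ GRP.optimalSet f C ∧
        ∀ i, Tendsto
          (fun k => GRP.iterate f C (x₀ s) (fun t => (I t s, J t s)) (fun t j => Ω t j s) k i)
          atTop (𝓝 (xstar s)) := by
  classical
  obtain ⟨r⟩ := hG.nonempty
  have hm : (0 : ℝ) < 1 / (m : ℝ) := by
    have : 0 < m := r.pos
    positivity
  have hP0 : ∀ i j, 0 ≤ P i j := fun i j => by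
    by_cases h : G.Adj i j
    · exact (hPpos i j h).le
    · exact (hPzero i j h).ge
  have hLip : ∀ i x y, ‖gradient (f i) x - gradient (f i) y‖ ≤ (∑ l, |L l|) * ‖x - y‖ :=
    fun i x y => (hfLip i x y).trans (mul_le_mul_of_nonneg_right ((le_abs_self _).trans
      (Finset.single_le_sum (f := fun l => |L l|) (fun _ _ => abs_nonneg _) (Finset.mem_univ i)))
      (norm_nonneg _))
  have hrow : ∀ i, ∑ j, 1 / (m : ℝ) * P i j = 1 / m := fun i => by
    rw [← Finset.mul_sum, hPsum, mul_one]
  -- reduction to bounded initial points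
  have hN : ∀ N : ℕ, ∀ᵐ s ∂μ, ‖x₀ s‖ ≤ N → ∃ z ∈ GRP.optimalSet f C, ∀ i, Tendsto
      (fun k => GRP.iterate f C (x₀ s) (fun t => (I t s, J t s)) (fun t j => Ω t j s) k i)
      atTop (𝓝 z) := by
    intro N
    -- Truncation is a measurable function of the initial points, so independence survives; the run
    -- is unchanged where `‖x₀‖ ≤ N`, and these events exhaust the space.
    set τ : (Fin m → EuclideanSpace ℝ (Fin d)) → Fin m → EuclideanSpace ℝ (Fin d) :=
      fun x => if ‖x‖ ≤ N then x else 0 with hτ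
    have hτm : Measurable τ :=
      Measurable.ite (measurableSet_le measurable_norm measurable_const) measurable_id
        measurable_const
    have hτb : ∀ s l, ‖τ (x₀ s) l‖ ≤ N := fun s l => by
      refine (norm_le_pi_norm _ l).trans ?_
      simp only [hτ]
      split_ifs with h
      · exact h
      · simp
    have := GRP.ae_exists_tendsto_iterate_of_bounded (μ := μ) (f := f) (C := C)
      (x₀ := fun s => τ (x₀ s)) (g := fun k s => (I k s, J k s)) (Ω := Ω)
      (q := fun i j => 1 / (m : ℝ) * P i j) (hτm.comp hx₀) (fun k => (hI k).prodMk (hJ k)) hΩ hG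
      (fun i j => mul_nonneg hm.le (hP0 i j)) (fun i j h => mul_pos hm (hPpos i j h))
      (fun i => by rw [hPzero i i (G.irrefl), mul_zero])
      (by
        simp only [hrow, Finset.sum_const, Finset.card_univ, Fintype.card_fin, nsmul_eq_mul]
        have : (m : ℝ) ≠ 0 := Nat.cast_ne_zero.2 r.pos.ne'
        field_simp)
      (fun i => by rw [hrow]; exact hm)
      (fun k e => by
        rw [← hgossip_law k e.1 e.2]
        congr 1
        ext s
        simp [Prod.ext_iff])
      hgossip_indep hindep (hindep₀.comp hτm measurable_id) hCclosed hCconvex hCmeas hfconvex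
      hfdiff (Finset.sum_nonneg fun l _ => abs_nonneg (L l)) hLip hfbdd hc hreg hopt hτb
    filter_upwards [this] with s hs hsN
    have e : τ (x₀ s) = x₀ s := if_pos hsN
    rwa [e] at hs
  have hall : ∀ᵐ s ∂μ, ∃ z ∈ GRP.optimalSet f C, ∀ i, Tendsto
      (fun k => GRP.iterate f C (x₀ s) (fun t => (I t s, J t s)) (fun t j => Ω t j s) k i)
      atTop (𝓝 z) := by
    filter_upwards [ae_all_iff.2 hN] with s hs
    obtain ⟨N, hN⟩ := exists_nat_ge ‖x₀ s‖
    exact hs N hN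
  have hne : ∀ i j, (C i j).Nonempty := fun i j =>
    (hopt.mono fun _ h => h.1).mono (GRP.feasibleSet_subset i j)
  have hgrad : ∀ i, Continuous (gradient (f i)) := fun i =>
    (LipschitzWith.of_dist_le_mul (K := Real.toNNReal (L i)) fun x y => by
      rw [dist_eq_norm, dist_eq_norm]
      exact (hfLip i x y).trans (mul_le_mul_of_nonneg_right (Real.le_coe_toNNReal _)
        (norm_nonneg _))).continuous
  have hmeas : ∀ k, Measurable fun s =>
      GRP.iterate f C (x₀ s) (fun t => (I t s, J t s)) (fun t j => Ω t j s) k r := fun k =>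
    (measurable_pi_apply r).comp ((GRP.measurable_iterate (g := fun k s => (I k s, J k s))
      (Ω := Ω) hCclosed hCconvex hCmeas hne hgrad k).mono
      (GRP.history_le hx₀ (fun k => (hI k).prodMk (hJ k)) hΩ k) le_rfl)
  -- The limits chosen pathwise need not be measurable; the almost sure limit of agent `r` alone is,
  -- and it agrees with them by uniqueness.
  obtain ⟨xstar, hxm, hxlim⟩ := measurable_limit_of_tendsto_metrizable_ae (μ := μ)
    (L := atTop) (fun k => (hmeas k).aemeasurable)
    (hall.mono fun s ⟨z, _, hz⟩ => ⟨z, hz r⟩)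
  refine ⟨xstar, hxm, ?_⟩
  filter_upwards [hall, hxlim] with s ⟨z, hz, hzlim⟩ hlim
  have : xstar s = z := tendsto_nhds_unique hlim (hzlim r)
  rw [this]
  exact ⟨hz, hzlim⟩
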